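/- Let $a\ge 1$ be an integer. Let $\overline{F}(a,a,a,a)$ be the circular fence poset with $4a$ nodes $x_1,\dots,x_{4a}$ (put $x_{4a+1}=x_1$), whose order is generated by $x_k<x_{k+1}$ for $1\le k\le a$ and for $2a+1\le k\le 3a$, and $x_k>x_{k+1}$ for $a+1\le k\le 2a$ and for $3a+1\le k\le 4a$. Rowmotion is the permutation of the lower order ideals of this poset that sends an ideal $I$ to the ideal generated by the minimal elements of the complement of $I$. For an orbit $\mathcal O$ of rowmotion, let $|\mathcal O|$ be its size, let $\mathcal M(\mathcal O)=\sum_{I\in\mathcal O}\#\{\text{maximal elements of } I\}$ and let $\overline\chi(\mathcal O)=\sum_{I\in\mathcal O}|I|$. Theorem. The orbits of rowmotion on $\overline{F}(a,a,a,a)$ are exactly the following: \begin{itemize} \item $a^3-4a^2+6a-3$ orbits of size $a$, with $\mathcal M(\mathcal O)=4a-4$ and $\overline\chi(\mathcal O)=2a|\mathcal O|$; \item $2a$ orbits of size $a+1$, with $\mathcal M(\mathcal O)=4a-2$; $a$ of them satisfy $\overline\chi(\mathcal O)=2a(|\mathcal O|+1)$ and the other $a$ satisfy $\overline\chi(\mathcal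 O)=2a(|\mathcal O|-1)$; \item one orbit of size $a+2$, with $\mathcal M(\mathcal O)=4a$ and $\overline\chi(\mathcal O)=2a|\mathcal O|$; \item $2a-2$ orbits of size $2a^2$, with $\mathcal M(\mathcal O)=8a^2-10a+4$; for each $r\in\{0,1,\dots,a-2\}$ there are two of them with $\overline\chi(\mathcal O)=4a^3-2a^2+4a+4ra$. \end{itemize} -/

import Mathlib

/-! ### Circular fence posets -/

/-- The nodes of the circular fence `F̄(α)` of a composition `α = (α₁, …, α₂ₛ)`.
The parts are indexed by `Fin (2 * s)` starting from `0`, so an *even* index is an *ascending*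
segment. The node `⟨i, j⟩`, `0 ≤ j < α i`, is the `j`-th node met when walking along segment `i`;
thus `⟨i, 0⟩` is the node shared by segment `i` and the (cyclically) preceding segment,
`⟨0, 0⟩` is `x₁ = x_{n+1}`, and there are `n = ∑ i, α i` nodes. -/
structure CircularFence {s : ℕ} (α : Fin (2 * s) → ℕ+) : Type where
  /-- The segment of the node. -/
  seg : Fin (2 * s)
  /-- The position of the node within its segment. -/
  pos : Fin (α seg : ℕ)

namespace CircularFence

variable {s : ℕ} {α : Fin (2 * s) → ℕ+}

/-- Nodes as dependent pairs. -/
def equivSigma : (Σ i : Fin (2 * s), Fin (α i : ℕ)) ≃ CircularFence α where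
  toFun p := ⟨p.1, p.2⟩
  invFun x := ⟨x.seg, x.pos⟩
  left_inv _ := rfl
  right_inv _ := rfl

instance : Fintype (CircularFence α) := Fintype.ofEquiv _ equivSigma

/-- The cyclically next segment. -/
def nextSegment (i : Fin (2 * s)) : Fin (2 * s) :=
  ⟨(i.val + 1) % (2 * s), Nat.mod_lt _ i.pos⟩

/-- The cyclically next node: `x_k ↦ x_{k+1}`, with `x_{n+1} = x₁`. The edge from `x` to `next x`
belongs to the segment of `x`. -/
def next (x : CircularFence α) : CircularFence α :=
  if h : x.pos.val + 1 < (α x.seg : ℕ) then ⟨x.seg, ⟨x.pos.val + 1, h⟩⟩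
  else ⟨nextSegment x.seg, ⟨0, (α (nextSegment x.seg)).pos⟩⟩

/-- `x` and `y` are neighbours on the circle and `x` is below `y`: either they are joined by an
edge of an ascending segment starting at `x`, or by an edge of a descending segment starting
at `y`. -/
def StepUp (x y : CircularFence α) : Prop :=
  (Even x.seg.val ∧ y = next x) ∨ (Odd y.seg.val ∧ x = next y)

/-- An auxiliary function, strictly increasing along each step up (used for antisymmetry only). -/
def height (x : CircularFence α) : ℚ :=
  if Even x.seg.val then (x.pos.val : ℚ) / (α x.seg : ℕ) else 1 - (x.pos.val : ℚ) / (α x.seg : ℕ)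

theorem even_nextSegment (i : Fin (2 * s)) : Even (nextSegment i).val ↔ ¬ Even i.val := by
  have h : (nextSegment i).val = (i.val + 1) % (2 * s) := rfl
  rw [h, Nat.even_iff, Nat.even_iff, Nat.mod_mul_right_mod]
  omega

theorem height_next_of_even (x : CircularFence α) (h : Even x.seg.val) :
    height x < height (next x) := by
  have hp : (0 : ℚ) < (α x.seg : ℕ) := by exact_mod_cast (α x.seg).pos
  have hx : (x.pos.val : ℚ) < (α x.seg : ℕ) := by exact_mod_cast x.pos.2
  by_cases h1 : x.pos.val + 1 < (α x.seg : ℕ)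
  · rw [next, dif_pos h1, height, if_pos h, height, if_pos h, div_lt_div_iff_of_pos_right hp]
    push_cast
    linarith
  · have h2 : ¬ Even (nextSegment x.seg).val := by rw [even_nextSegment]; exact not_not.2 h
    rw [next, dif_neg h1, height, if_pos h, height, if_neg h2, div_lt_iff₀ hp]
    simp

theorem height_next_of_odd (x : CircularFence α) (h : Odd x.seg.val) :
    height (next x) < height x := by
  have hp : (0 : ℚ) < (α x.seg : ℕ) := by exact_mod_cast (α x.seg).pos
  have hx : (x.pos.val : ℚ) < (α x.seg : ℕ) := by exact_mod_cast x.pos.2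
  have h' : ¬ Even x.seg.val := Nat.not_even_iff_odd.2 h
  by_cases h1 : x.pos.val + 1 < (α x.seg : ℕ)
  · rw [next, dif_pos h1, height, if_neg h', height, if_neg h', sub_lt_sub_iff_left,
      div_lt_div_iff_of_pos_right hp]
    push_cast
    linarith
  · have h2 : Even (nextSegment x.seg).val := by rw [even_nextSegment]; exact h'
    rw [next, dif_neg h1, height, if_pos h2, height, if_neg h']
    have : (x.pos.val : ℚ) / (α x.seg : ℕ) < 1 := by rw [div_lt_one hp]; exact hx
    simp only [Nat.cast_zero, zero_div, sub_pos]
    exact this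

theorem height_lt_of_stepUp {x y : CircularFence α} (h : StepUp x y) : height x < height y := by
  rcases h with ⟨h, rfl⟩ | ⟨h, rfl⟩
  · exact height_next_of_even x h
  · exact height_next_of_odd y h

theorem eq_or_height_lt {x y : CircularFence α} (h : Relation.ReflTransGen StepUp x y) :
    x = y ∨ height x < height y := by
  induction h with
  | refl => exact Or.inl rfl
  | tail _ hs ih =>
    right
    rcases ih with rfl | ih
    · exact height_lt_of_stepUp hs
    · exact ih.trans (height_lt_of_stepUp hs)

/-- The circular fence poset: the order generated by the steps up. -/
instance : PartialOrder (CircularFence α) where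
  le := Relation.ReflTransGen StepUp
  le_refl _ := Relation.ReflTransGen.refl
  le_trans _ _ _ := Relation.ReflTransGen.trans
  le_antisymm x y hxy hyx := by
    rcases eq_or_height_lt hxy with h | h
    · exact h
    · rcases eq_or_height_lt hyx with h' | h'
      · exact h'.symm
      · exact absurd h (not_lt.2 h'.le)

end CircularFence

/-! ### Rowmotion on the (lower) order ideals of a finite poset -/

namespace Rowmotion

variable {P : Type*} [PartialOrder P]

/-- The order ideal generated by the minimal elements of the complement of `I`. -/
def step (I : LowerSet P) : LowerSet P :=
  lowerClosure {x | Minimal (fun y => y ∉ I) x}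

/-- The complement of the upper order ideal generated by the maximal elements of `I`. -/
def stepInv (I : LowerSet P) : LowerSet P :=
  (upperClosure {x | Maximal (fun y => y ∈ I) x}).compl

theorem maximal_step (I : LowerSet P) (x : P) :
    Maximal (fun y => y ∈ step I) x ↔ Minimal (fun y => y ∉ I) x := by
  constructor
  · rintro ⟨⟨z, hz, hxz⟩, h2⟩
    have := h2 (subset_lowerClosure (s := {x | Minimal (fun y => y ∉ I) x}) hz) hxz
    rwa [le_antisymm hxz this]
  · intro hx
    refine ⟨subset_lowerClosure (s := {x | Minimal (fun y => y ∉ I) x}) hx, ?_⟩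
    rintro y ⟨z, hz, hyz⟩ hxy
    exact hyz.trans (hz.2 hx.1 (hxy.trans hyz))

theorem minimal_stepInv (I : LowerSet P) (x : P) :
    Minimal (fun y => y ∉ stepInv I) x ↔ Maximal (fun y => y ∈ I) x := by
  have key : ∀ y, y ∉ stepInv I ↔ ∃ z, Maximal (fun y => y ∈ I) z ∧ z ≤ y := by
    intro y
    simp [stepInv, UpperSet.mem_compl_iff, mem_upperClosure]
  simp only [key]
  constructor
  · rintro ⟨⟨z, hz, hzx⟩, h2⟩
    have := h2 ⟨z, hz, le_rfl⟩ hzx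
    rwa [le_antisymm this hzx]
  · intro hx
    refine ⟨⟨x, hx, le_rfl⟩, ?_⟩
    rintro y ⟨z, hz, hzy⟩ hyx
    exact (hz.2 hx.1 (hzy.trans hyx)).trans hzy

theorem stepInv_step [Finite P] (I : LowerSet P) : stepInv (step I) = I := by
  ext y
  simp only [stepInv, maximal_step, SetLike.mem_coe, UpperSet.mem_compl_iff, mem_upperClosure,
    Set.mem_ofPred_eq]
  constructor
  · intro h
    by_contra hy
    obtain ⟨m, hm, hmin⟩ := Set.Finite.exists_le_minimal (Set.toFinite {y | y ∉ I}) hy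
    exact h ⟨m, hmin, hm⟩
  · rintro hy ⟨z, hz, hzy⟩
    exact hz.1 (I.lower hzy hy)

theorem step_stepInv [Finite P] (I : LowerSet P) : step (stepInv I) = I := by
  ext y
  simp only [step, minimal_stepInv, SetLike.mem_coe, mem_lowerClosure, Set.mem_ofPred_eq]
  constructor
  · rintro ⟨z, hz, hyz⟩
    exact I.lower hyz hz.1
  · intro hy
    obtain ⟨m, hm, hmax⟩ := Set.Finite.exists_le_maximal (Set.toFinite {y | y ∈ I}) hy
    exact ⟨m, hmax, hm⟩

/-- Rowmotion, as a permutation of the order ideals of a finite poset. -/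
def rowmotion (P : Type*) [PartialOrder P] [Finite P] : Equiv.Perm (LowerSet P) where
  toFun := step
  invFun := stepInv
  left_inv := stepInv_step
  right_inv := step_stepInv

/-- The orbits of rowmotion, i.e. the orbits of the cyclic group generated by it. -/
noncomputable def orbits (P : Type*) [PartialOrder P] [Finite P] : Finset (Set (LowerSet P)) :=
  (Set.toFinite (Set.range fun I : LowerSet P =>
    MulAction.orbit (Subgroup.zpowers (rowmotion P)) I)).toFinset

/-- `ℳ_x(𝒪)`: the number of times `x` occurs as a maximal element of an ideal in `𝒪`. -/
noncomputable def maxCountAt (x : P) (O : Set (LowerSet P)) : ℕ :=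
  {I ∈ O | Maximal (fun y => y ∈ I) x}.ncard

/-- `ℳ(𝒪) = ∑ x, ℳ_x(𝒪)`. -/
noncomputable def maxCount [Fintype P] (O : Set (LowerSet P)) : ℕ :=
  ∑ x : P, maxCountAt x O

/-- `χ̄_x(𝒪)`: the number of ideals in `𝒪` that contain `x`. -/
noncomputable def chiAt (x : P) (O : Set (LowerSet P)) : ℕ :=
  {I ∈ O | x ∈ I}.ncard

/-- `χ̄(𝒪) = ∑ x, χ̄_x(𝒪)`. -/
noncomputable def chi [Fintype P] (O : Set (LowerSet P)) : ℕ :=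
  ∑ x : P, chiAt x O

/-- The multiset of the triples `(|𝒪|, ℳ(𝒪), χ̄(𝒪))`, one for each rowmotion orbit `𝒪`. -/
noncomputable def orbitData (P : Type*) [PartialOrder P] [Fintype P] : Multiset (ℤ × ℤ × ℤ) :=
  (orbits P).val.map fun O => ((O.ncard : ℤ), (maxCount O : ℤ), (chi O : ℤ))

end Rowmotion

/-! The poset is four chains of `a + 1` nodes glued cyclically, alternately at maxima (`mx`) and
minima (`mn`). An ideal is recorded by how many nodes it has on each chain. On these height vectors
rowmotion (`rot`, via `ht_step`) is nearly four independent counters: a height grows by one until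
the chain falls. A chain with `h i = a` rises to `a + 1` only if its partner at the maximum is also
at `a`; a falling chain lands at `0` if its partner at the minimum falls too, and at `1` otherwise.

If synchrony across minima is all or nothing, and likewise across maxima, all counters share one
range `{lo, …, hi}` with `lo ∈ {0, 1}` and `hi ∈ {a, a + 1}` (`Tame`), and the periods are `a`, `a +
1`, `a + 1` and `a + 2`. The period-`a` vectors are proper colourings of a four-cycle, whence the
cubic count. Otherwise a single synchronous pair needs `a + 1` steps per round while the other two
chains need `a` and so gain one step per round, until one of them meets the pair at a shared
maximum, or falls together with a member of the pair at a shared minimum, and the synchrony moves to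
a new pair. After `a ^ 2` steps the vector has made a half turn (`path_swap_half`), which gives
period `2 * a ^ 2`.

Distinctness of orbits and minimality of periods are never checked by hand. Every vector reaches a
listed representative (`exists_iterate_eq_rep`), and the claimed periods sum to `a ^ 4 + 4 * a ^ 2 +
2` (`sum_len`), which is at most the number of ideals (`le_card_lowerSet`). So the representatives
and their iterates exhaust the ideals without repetition (`bijective_iterate_of_cover`).

Both statistics are sums over the chains of a function of the height, for the maximal elements only
after summing over a period. `Path` therefore carries the sum of an arbitrary weight `φ`, and one
computation per orbit serves both. -/

/-! ### Recognising the orbits of a permutation from periodic representatives -/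

namespace Rowmotion

section Cover

variable {X ι : Type*} {T : Equiv.Perm X} {x : ι → X} {n : ι → ℕ}

/-- Covering makes the map surjective and the cardinality bound then forces injectivity. This yields
disjointness of the orbits and minimality of the periods at once. -/
theorem bijective_iterate_of_cover [Fintype X] [Fintype ι] (hn : ∀ j, 0 < n j) (hper : ∀ j, T^[n j] (x j) = x j)
    (hcov : ∀ y, ∃ j k, T^[k] y = x j) (hcard : ∑ j, n j ≤ Fintype.card X) :
    Function.Bijective fun p : Σ j, Fin (n j) => T^[p.2.val] (x p.1) := by
  have hsurj : Function.Surjective fun p : Σ j, Fin (n j) => T^[p.2.val] (x p.1) := by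
    intro y
    obtain ⟨j, k, hk⟩ := hcov y
    have hp : Function.IsPeriodicPt T (n j) (x j) := hper j
    have hy : Function.IsPeriodicPt T (n j) y := by
      have h1 : T^[k] (T^[n j] y) = T^[k] y := by
        rw [← Function.iterate_add_apply, add_comm, Function.iterate_add_apply, hk, hper]
      exact T.injective.iterate k h1
    -- Going back `k` steps is going forward `n j * k - k` steps, since `y` inherits the period `n
    -- j`.
    have h2 : T^[n j * k - k] (x j) = y := by
      rw [← hk, ← Function.iterate_add_apply, Nat.sub_add_cancel (Nat.le_mul_of_pos_left k (hn j))]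
      exact hy.mul_const k
    refine ⟨⟨j, ⟨(n j * k - k) % n j, Nat.mod_lt _ (hn j)⟩⟩, ?_⟩
    simp only
    rw [hp.iterate_mod_apply, h2]
  refine (Fintype.bijective_iff_surjective_and_card _).2 ⟨hsurj, le_antisymm ?_ ?_⟩
  · simpa using hcard
  · exact Fintype.card_le_of_surjective _ hsurj

theorem orbit_eq_range [Finite X] (hn : ∀ j, 0 < n j) (hper : ∀ j, T^[n j] (x j) = x j) (j : ι) :
    MulAction.orbit (Subgroup.zpowers T) (x j) =
      Set.range fun k : Fin (n j) => T^[k.val] (x j) := by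
  have hp : Function.IsPeriodicPt T (n j) (x j) := hper j
  have hpow : ∀ m : ℕ, (T ^ m) (x j) = T^[m] (x j) := fun m => by rw [Equiv.Perm.iterate_eq_pow]
  ext y
  constructor
  · rintro ⟨⟨g, hg⟩, rfl⟩
    obtain ⟨m, rfl⟩ := (mem_powers_iff_mem_zpowers).2 hg
    refine ⟨⟨m % n j, Nat.mod_lt _ (hn j)⟩, ?_⟩
    simp only
    rw [hp.iterate_mod_apply, ← hpow]
    rfl
  · rintro ⟨k, rfl⟩
    exact ⟨⟨T ^ k.val, ⟨(k.val : ℤ), by simp⟩⟩, hpow k⟩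

variable [Fintype X] [Fintype ι] (hn : ∀ j, 0 < n j) (hper : ∀ j, T^[n j] (x j) = x j)
  (hcov : ∀ y, ∃ j k, T^[k] y = x j) (hcard : ∑ j, n j ≤ Fintype.card X)

include hn hper hcov hcard

theorem orbit_injective :
    Function.Injective fun j => MulAction.orbit (Subgroup.zpowers T) (x j) := by
  intro i j hij
  have hb := bijective_iterate_of_cover hn hper hcov hcard
  have : x i ∈ MulAction.orbit (Subgroup.zpowers T) (x j) := by
    have h := MulAction.mem_orbit_self (M := Subgroup.zpowers T) (x i)
    simp only at hij
    rwa [hij] at h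
  rw [orbit_eq_range hn hper] at this
  obtain ⟨k, hk⟩ := this
  have := @hb.1 ⟨j, k⟩ ⟨i, ⟨0, hn i⟩⟩ hk
  exact (congrArg Sigma.fst this).symm

theorem ncard_orbit_filter (j : ι) (Q : X → Prop) [DecidablePred Q] :
    {y ∈ MulAction.orbit (Subgroup.zpowers T) (x j) | Q y}.ncard =
      ∑ k ∈ Finset.range (n j), if Q (T^[k] (x j)) then 1 else 0 := by
  classical
  have hb := bijective_iterate_of_cover hn hper hcov hcard
  have hinj : Function.Injective fun k : Fin (n j) => T^[k.val] (x j) := by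
    intro k l hkl
    have := @hb.1 ⟨j, k⟩ ⟨j, l⟩ hkl
    simpa using this
  have : {y ∈ MulAction.orbit (Subgroup.zpowers T) (x j) | Q y} =
      ((Finset.univ.filter fun k : Fin (n j) => Q (T^[k.val] (x j))).image
        fun k : Fin (n j) => T^[k.val] (x j) : Finset X) := by
    rw [orbit_eq_range hn hper]
    ext y
    simp only [Set.mem_range, Set.mem_ofPred_eq, Finset.coe_image, Finset.coe_filter,
      Finset.mem_univ, true_and, Set.mem_image]
    constructor
    · rintro ⟨⟨k, rfl⟩, hQ⟩
      exact ⟨k, hQ, rfl⟩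
    · rintro ⟨k, hQ, rfl⟩
      exact ⟨⟨k, rfl⟩, hQ⟩
  rw [this, Set.ncard_coe_finset, Finset.card_image_of_injective _ hinj, Finset.card_filter,
    Fin.sum_univ_eq_sum_range (fun k => if Q (T^[k] (x j)) then 1 else 0)]

theorem ncard_orbit (j : ι) : (MulAction.orbit (Subgroup.zpowers T) (x j)).ncard = n j := by
  have := ncard_orbit_filter hn hper hcov hcard j (fun _ => True)
  simpa using this

end Cover

section Data

open scoped Classical in
/-- The orbit data of rowmotion, read off from a covering family of periodic representatives. -/
theorem orbitData_eq {P ι : Type*} [PartialOrder P] [Fintype P] [Fintype (LowerSet P)] [Fintype ι]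
    {x : ι → LowerSet P}
    {n : ι → ℕ} (hn : ∀ j, 0 < n j) (hper : ∀ j, (rowmotion P)^[n j] (x j) = x j)
    (hcov : ∀ y, ∃ j k, (rowmotion P)^[k] y = x j) (hcard : ∑ j, n j ≤ Fintype.card (LowerSet P)) :
    orbitData P = Finset.univ.val.map fun j : ι => ((n j : ℤ),
      ((∑ k ∈ Finset.range (n j),
        ∑ v : P, if Maximal (fun y => y ∈ (rowmotion P)^[k] (x j)) v then 1 else 0 : ℕ) : ℤ),
      ((∑ k ∈ Finset.range (n j),
        ∑ v : P, if v ∈ (rowmotion P)^[k] (x j) then 1 else 0 : ℕ) : ℤ)) := by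
  have hinj := orbit_injective hn hper hcov hcard
  have ho : orbits P = Finset.univ.map
      ⟨fun j => MulAction.orbit (Subgroup.zpowers (rowmotion P)) (x j), hinj⟩ := by
    ext O
    simp only [orbits, Set.Finite.mem_toFinset, Set.mem_range, Finset.mem_map, Finset.mem_univ,
      true_and, Function.Embedding.coeFn_mk]
    constructor
    · rintro ⟨y, rfl⟩
      obtain ⟨j, k, hk⟩ := hcov y
      refine ⟨j, ?_⟩
      rw [← hk, MulAction.orbit_eq_iff]
      exact ⟨⟨rowmotion P ^ k, ⟨(k : ℤ), by simp⟩⟩, by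
        rw [Equiv.Perm.iterate_eq_pow]; rfl⟩
    · rintro ⟨j, rfl⟩
      exact ⟨x j, rfl⟩
  rw [orbitData, ho, Finset.map_val, Multiset.map_map]
  refine Multiset.map_congr rfl fun j _ => ?_
  simp only [Function.comp_apply, Function.Embedding.coeFn_mk]
  rw [ncard_orbit hn hper hcov hcard]
  have h1 : maxCount (MulAction.orbit (Subgroup.zpowers (rowmotion P)) (x j)) =
      ∑ k ∈ Finset.range (n j),
        ∑ v : P, if Maximal (fun y => y ∈ (rowmotion P)^[k] (x j)) v then 1 else 0 := by
    rw [Finset.sum_comm]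
    exact Finset.sum_congr rfl fun v _ => ncard_orbit_filter hn hper hcov hcard j _
  have h2 : chi (MulAction.orbit (Subgroup.zpowers (rowmotion P)) (x j)) =
      ∑ k ∈ Finset.range (n j), ∑ v : P, if v ∈ (rowmotion P)^[k] (x j) then 1 else 0 := by
    rw [Finset.sum_comm]
    exact Finset.sum_congr rfl fun v _ => ncard_orbit_filter hn hper hcov hcard j _
  rw [h1, h2]

end Data

end Rowmotion

/-! ### The fence `F̄(a, a, a, a)` as a union of four chains -/

namespace FourFence

/-- The circular fence `F̄(a, a, a, a)`. -/
abbrev Fence (a : ℕ) (ha : 0 < a) : Type := CircularFence (s := 2) (fun _ => a.toPNat ha)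

/-- The chain with the same maximum. -/
def mx : Fin 4 → Fin 4 := ![1, 0, 3, 2]

/-- The chain with the same minimum. -/
def mn : Fin 4 → Fin 4 := ![3, 2, 1, 0]

@[simp] theorem mx_mx (i : Fin 4) : mx (mx i) = i := by fin_cases i <;> rfl
@[simp] theorem mn_mn (i : Fin 4) : mn (mn i) = i := by fin_cases i <;> rfl

variable {a : ℕ} {ha : 0 < a}

/-- The node on a given segment at a given position (reduced modulo `a`). -/
def mk (ha : 0 < a) (i : Fin 4) (k : ℕ) : Fence a ha := ⟨i, ⟨k % a, Nat.mod_lt _ ha⟩⟩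

/-- The node of height `k` on the `i`-th maximal chain, for `k ≤ a`. -/
def nd (ha : 0 < a) (i : Fin 4) (k : ℕ) : Fence a ha :=
  match i with
  | 0 => if k < a then mk ha 0 k else mk ha 1 0
  | 1 => if 0 < k then mk ha 1 (a - k) else mk ha 2 0
  | 2 => if k < a then mk ha 2 k else mk ha 3 0
  | 3 => if 0 < k then mk ha 3 (a - k) else mk ha 0 0

theorem mk_eq_mk {i j : Fin 4} {k l : ℕ} (hk : k < a) (hl : l < a) :
    mk ha i k = mk ha j l ↔ i = j ∧ k = l := by
  constructor
  · intro h
    have h1 : i = j := congrArg CircularFence.seg h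
    subst h1
    refine ⟨rfl, ?_⟩
    have h2 := congrArg (fun x : Fence a ha => x.pos.val) h
    simpa [mk, Nat.mod_eq_of_lt hk, Nat.mod_eq_of_lt hl] using h2
  · rintro ⟨rfl, rfl⟩
    rfl

theorem mk_surj (x : Fence a ha) : ∃ i k, k < a ∧ x = mk ha i k := by
  refine ⟨x.seg, x.pos.val, x.pos.2, ?_⟩
  obtain ⟨i, k, hk⟩ := x
  have hk' : k < a := hk
  simp [mk, Nat.mod_eq_of_lt hk']

theorem seg_mk (i : Fin 4) (k : ℕ) : (mk ha i k).seg = i := rfl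

theorem next_mk {i : Fin 4} {k : ℕ} (hk : k < a) :
    CircularFence.next (mk ha i k) = if k + 1 < a then mk ha i (k + 1) else mk ha (i + 1) 0 := by
  by_cases h : k + 1 < a
  · have : (mk ha i k).pos.val + 1 < ((fun _ => a.toPNat ha : Fin (2 * 2) → ℕ+) (mk ha i k).seg : ℕ)
        := by
      show k % a + 1 < a
      rwa [Nat.mod_eq_of_lt hk]
    rw [if_pos h, CircularFence.next, dif_pos this]
    simp [mk, Nat.mod_eq_of_lt hk, Nat.mod_eq_of_lt h]
  · have : ¬ (mk ha i k).pos.val + 1 < ((fun _ => a.toPNat ha : Fin (2 * 2) → ℕ+) (mk ha i k).seg : ℕ)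
        := by
      show ¬ k % a + 1 < a
      rwa [Nat.mod_eq_of_lt hk]
    rw [if_neg h, CircularFence.next, dif_neg this]
    have h2 : CircularFence.nextSegment (s := 2) (mk ha i k).seg = i + 1 := by
      rw [seg_mk]
      clear this h
      revert i
      decide
    rw [h2]
    simp [mk]

theorem nd_eq_nd {i j : Fin 4} {k l : ℕ} (hk : k ≤ a) (hl : l ≤ a) :
    nd ha i k = nd ha j l ↔ k = l ∧ (i = j ∨ (k = a ∧ j = mx i) ∨ (k = 0 ∧ j = mn i)) := by
  fin_cases i <;> fin_cases j <;> simp only [nd, mx, mn] <;> split_ifs <;>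
    rw [mk_eq_mk (by omega) (by omega)] <;> simp <;> omega

theorem nd_surj (x : Fence a ha) : ∃ i k, k ≤ a ∧ x = nd ha i k := by
  obtain ⟨i, k, hk, rfl⟩ := mk_surj x
  fin_cases i
  · exact ⟨0, k, hk.le, by simp [nd, hk]⟩
  · rcases Nat.eq_zero_or_pos k with rfl | h
    · exact ⟨1, a, le_rfl, by simp [nd, ha]⟩
    · exact ⟨1, a - k, by omega, by simp [nd, hk, Nat.sub_sub_self hk.le]⟩
  · exact ⟨2, k, hk.le, by simp [nd, hk]⟩
  · rcases Nat.eq_zero_or_pos k with rfl | h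
    · exact ⟨3, a, le_rfl, by simp [nd, ha]⟩
    · exact ⟨3, a - k, by omega, by simp [nd, hk, Nat.sub_sub_self hk.le]⟩

theorem stepUp_nd {i : Fin 4} {k : ℕ} (hk : k < a) :
    CircularFence.StepUp (nd ha i k) (nd ha i (k + 1)) := by
  fin_cases i
  · left
    simp only [nd, if_pos hk]
    refine ⟨by rw [seg_mk]; decide, ?_⟩
    rw [next_mk hk]; rfl
  · right
    simp only [nd, if_pos k.succ_pos]
    refine ⟨by rw [seg_mk]; decide, ?_⟩
    rw [next_mk (by omega)]
    split_ifs
    · congr 1; omega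
    · omega
    · omega
    · rfl
  · left
    simp only [nd, if_pos hk]
    refine ⟨by rw [seg_mk]; decide, ?_⟩
    rw [next_mk hk]; rfl
  · right
    simp only [nd, if_pos k.succ_pos]
    refine ⟨by rw [seg_mk]; decide, ?_⟩
    rw [next_mk (by omega)]
    split_ifs
    · congr 1; omega
    · omega
    · omega
    · rfl

theorem stepUp_iff {x y : Fence a ha} :
    CircularFence.StepUp x y ↔ ∃ i k, k < a ∧ x = nd ha i k ∧ y = nd ha i (k + 1) := by
  constructor
  · rintro (⟨h, rfl⟩ | ⟨h, rfl⟩)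
    · obtain ⟨i, k, hk, rfl⟩ := mk_surj x
      rw [seg_mk] at h
      refine ⟨i, k, hk, ?_⟩
      rw [next_mk hk]
      fin_cases i
      · simp only [nd, if_pos hk]; exact ⟨rfl, rfl⟩
      · exact absurd h (by decide)
      · simp only [nd, if_pos hk]; exact ⟨rfl, rfl⟩
      · exact absurd h (by decide)
    · obtain ⟨i, k, hk, rfl⟩ := mk_surj y
      rw [seg_mk] at h
      refine ⟨i, a - k - 1, by omega, ?_⟩
      rw [next_mk hk]
      have h1 : a - (a - k - 1) = k + 1 := by omega
      have h2 : a - (a - k - 1 + 1) = k := by omega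
      have h3 : 0 < a - k - 1 ↔ k + 1 < a := by omega
      have h4 : (0 : ℕ) < a - k - 1 + 1 := by omega
      fin_cases i
      · exact absurd h (by decide)
      · simp only [nd, h1, h2, h3, if_pos h4]; exact ⟨rfl, rfl⟩
      · exact absurd h (by decide)
      · simp only [nd, h1, h2, h3, if_pos h4]; exact ⟨rfl, rfl⟩
  · rintro ⟨i, k, hk, rfl, rfl⟩
    exact stepUp_nd hk

theorem nd_le_nd {i : Fin 4} {k l : ℕ} (hkl : k ≤ l) (hl : l ≤ a) : nd ha i k ≤ nd ha i l := by
  induction l, hkl using Nat.le_induction with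
  | base => exact le_rfl
  | succ l _ ih => exact (ih (by omega)).trans (Relation.ReflTransGen.single (stepUp_nd (by omega)))

/-- The chains meet only in maximal and minimal nodes, so an upward walk can never pass from the
middle of one chain to another. -/
theorem le_iff {x y : Fence a ha} :
    x ≤ y ↔ ∃ i k l, k ≤ l ∧ l ≤ a ∧ x = nd ha i k ∧ y = nd ha i l := by
  constructor
  · intro h
    change Relation.ReflTransGen CircularFence.StepUp x y at h
    induction h with
    | refl =>
      obtain ⟨i, k, hk, rfl⟩ := nd_surj x
      exact ⟨i, k, k, le_rfl, hk, rfl, rfl⟩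
    | tail _ hs ih =>
      obtain ⟨i, k, l, hkl, hl, rfl, rfl⟩ := ih
      obtain ⟨j, m, hm, hy, rfl⟩ := stepUp_iff.1 hs
      rw [nd_eq_nd hl hm.le] at hy
      obtain ⟨rfl, rfl | ⟨rfl, -⟩ | ⟨rfl, rfl⟩⟩ := hy
      · exact ⟨i, k, l + 1, by omega, hm, rfl, rfl⟩
      · omega
      -- The walk is still at a shared minimum, so it can be relabelled as starting on the
      -- neighbouring chain.
      · obtain rfl : k = 0 := by omega
        exact ⟨mn i, 0, 1, by omega, hm, (nd_eq_nd hl hl).2 ⟨rfl, by simp⟩, rfl⟩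
  · rintro ⟨i, k, l, hkl, hl, rfl, rfl⟩
    exact nd_le_nd hkl hl

/-- Each shared node is assigned to one of its two chains: chains `0` and `2` keep their minima,
chains `1` and `3` their maxima. -/
theorem sum_fence (f : Fence a ha → ℕ) :
    ∑ v, f v = ∑ k ∈ Finset.range a, f (nd ha 0 k) + ∑ k ∈ Finset.range a, f (nd ha 1 (k + 1)) +
      ∑ k ∈ Finset.range a, f (nd ha 2 k) + ∑ k ∈ Finset.range a, f (nd ha 3 (k + 1)) := by
  have h0 : ∀ i : Fin 4, ∑ k : Fin a, f ⟨i, k⟩ = ∑ k ∈ Finset.range a, f (mk ha i k) := by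
    intro i
    rw [← Fin.sum_univ_eq_sum_range (fun k => f (mk ha i k))]
    refine Finset.sum_congr rfl fun k _ => ?_
    congr 2
    exact Fin.ext (Nat.mod_eq_of_lt k.2).symm
  have h1 : ∑ v, f v = ∑ i : Fin 4, ∑ k : Fin a, f ⟨i, k⟩ := by
    rw [← Equiv.sum_comp CircularFence.equivSigma f, Fintype.sum_sigma]
    rfl
  have h2 : ∀ i : Fin 4, ∑ k ∈ Finset.range a, f (mk ha i k) =
      ∑ k ∈ Finset.range a, f (mk ha i (a - (k + 1))) := by
    intro i
    rw [← Finset.sum_range_reflect]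
    refine Finset.sum_congr rfl fun k _ => ?_
    congr 2
    omega
  rw [h1, Fin.sum_univ_four]
  simp only [h0]
  rw [h2 1, h2 3]
  congr 1
  congr 1
  congr 1
  all_goals
    refine Finset.sum_congr rfl fun k hk => ?_
    simp [nd, Finset.mem_range.1 hk]

end FourFence

/-! ### Order ideals of `F̄(a, a, a, a)` as height vectors -/

namespace FourFence

open Rowmotion

/-- The height vectors of order ideals: `h i` is the number of elements on the `i`-th chain. -/
def Valid (a : ℕ) (h : Fin 4 → ℕ) : Prop :=
  ∀ i, h i ≤ a + 1 ∧ (h i = 0 ↔ h (mn i) = 0) ∧ (h i = a + 1 ↔ h (mx i) = a + 1)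

/-- Rowmotion removes the top element of the `i`-th chain part of the ideal. -/
def Falls (a : ℕ) (h : Fin 4 → ℕ) (i : Fin 4) : Prop :=
  h i = a + 1 ∨ (h i = a ∧ h (mx i) ≠ a)

instance (a : ℕ) (h : Fin 4 → ℕ) (i : Fin 4) : Decidable (Falls a h i) :=
  inferInstanceAs (Decidable (_ ∨ _))

/-- Rowmotion on height vectors. -/
def rot (a : ℕ) (h : Fin 4 → ℕ) (i : Fin 4) : ℕ :=
  if Falls a h i then (if Falls a h (mn i) then 0 else 1) else h i + 1

variable {a : ℕ} {ha : 0 < a}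

/-- The height vector of an order ideal. -/
noncomputable def ht (I : LowerSet (Fence a ha)) (i : Fin 4) : ℕ :=
  sInf {k | k ≤ a → nd ha i k ∉ I}

/-- `k = a + 1` lies vacuously in the set defining `ht`; this is the value taken on a chain
contained in `I`. -/
theorem ht_le (I : LowerSet (Fence a ha)) (i : Fin 4) : ht I i ≤ a + 1 :=
  Nat.sInf_le fun h => absurd h (by omega)

theorem nd_mem_iff (I : LowerSet (Fence a ha)) {i : Fin 4} {k : ℕ} (hk : k ≤ a) :
    nd ha i k ∈ I ↔ k < ht I i := by
  constructor
  · intro h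
    by_contra! hlt
    have hmem : ht I i ∈ {k | k ≤ a → nd ha i k ∉ I} :=
      Nat.sInf_mem ⟨a + 1, fun h => absurd h (by omega)⟩
    exact hmem (hlt.trans hk) (I.lower (nd_le_nd hlt hk) h)
  · intro h
    have := Nat.notMem_of_lt_sInf h
    simp only [Set.mem_ofPred_eq, not_forall, not_not] at this
    exact this.2

theorem ht_unique {I : LowerSet (Fence a ha)} {h : Fin 4 → ℕ} (hle : ∀ i, h i ≤ a + 1)
    (hmem : ∀ i k, k ≤ a → (nd ha i k ∈ I ↔ k < h i)) : ht I = h := by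
  funext i
  have h1 := hle i
  have h2 := ht_le I i
  by_contra hne
  rcases Nat.lt_or_gt_of_ne hne with hlt | hlt
  · have := (hmem i (ht I i) (by omega)).2 hlt
    rw [nd_mem_iff I (by omega)] at this
    omega
  · have := (nd_mem_iff I (by omega)).2 hlt
    rw [hmem i (h i) (by omega)] at this
    omega

theorem ht_injective : Function.Injective (ht (ha := ha)) := by
  intro I J h
  ext x
  obtain ⟨i, k, hk, rfl⟩ := nd_surj x
  simp only [SetLike.mem_coe, nd_mem_iff _ hk, h]

theorem nd_mx (i : Fin 4) : nd ha i a = nd ha (mx i) a := (nd_eq_nd le_rfl le_rfl).2 (by simp)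

theorem nd_mn (i : Fin 4) : nd ha i 0 = nd ha (mn i) 0 :=
  (nd_eq_nd (Nat.zero_le _) (Nat.zero_le _)).2 (by simp)

theorem valid_ht (I : LowerSet (Fence a ha)) : Valid a (ht I) := by
  intro i
  have h0 := ht_le I i
  have h1 := ht_le I (mx i)
  have h2 := nd_mem_iff I (i := i) le_rfl
  have h3 := nd_mem_iff I (i := i) (Nat.zero_le a)
  rw [nd_mx, nd_mem_iff I le_rfl] at h2
  rw [nd_mn, nd_mem_iff I (Nat.zero_le a)] at h3
  omega

/-- Validity is exactly what makes the test `k < h i` independent of the chain used to name a shared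
node. -/
theorem exists_ht_eq {h : Fin 4 → ℕ} (hv : Valid a h) :
    ∃ I : LowerSet (Fence a ha), ht I = h := by
  have key : ∀ {i j k l}, k ≤ a → l ≤ a → nd ha i k = nd ha j l → (k < h i ↔ l < h j) := by
    intro i j k l hk hl he
    obtain ⟨rfl, rfl | ⟨rfl, rfl⟩ | ⟨rfl, rfl⟩⟩ := (nd_eq_nd hk hl).1 he
    · rfl
    · have := hv i; have := hv (mx i); omega
    · have := hv i; have := hv (mn i); omega
  refine ⟨⟨{x | ∃ i k, k ≤ a ∧ x = nd ha i k ∧ k < h i}, ?_⟩, ?_⟩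
  · rintro x y hyx ⟨i, k, hk, rfl, hlt⟩
    obtain ⟨j, l, m, hlm, hm, rfl, he⟩ := le_iff.1 hyx
    exact ⟨j, l, hlm.trans hm, rfl, lt_of_le_of_lt hlm ((key hk hm he).1 hlt)⟩
  · refine ht_unique (fun i => (hv i).1) fun i k hk => ?_
    constructor
    · rintro ⟨j, l, hl, he, hlt⟩
      exact (key hk hl he).2 hlt
    · intro hlt
      exact ⟨i, k, hk, rfl, hlt⟩

/-- A node is minimal outside `I` when all its lower covers lie in `I`. Only a shared maximum has
two of them, and this produces the condition on `mx i` in `Falls`. -/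
theorem minimal_nd_iff (I : LowerSet (Fence a ha)) {i : Fin 4} {k : ℕ} (hk : k ≤ a) :
    Minimal (fun y => y ∉ I) (nd ha i k) ↔ ht I i = k ∧ ¬ Falls a (ht I) i := by
  have hv := valid_ht I
  have h1 := hv i
  have h2 := hv (mx i)
  constructor
  · rintro ⟨hnot, hmin⟩
    rw [nd_mem_iff I hk] at hnot
    have hlow : ∀ j l, l + 1 ≤ a → nd ha i k = nd ha j (l + 1) → l < ht I j := by
      intro j l hl he
      by_contra hn
      have h3 := hmin (y := nd ha j l) (show _ ∉ I by rwa [nd_mem_iff I (by omega)])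
        (he ▸ nd_le_nd (by omega) hl)
      rw [he] at h3
      have h4 := (nd_eq_nd (by omega) hl).1 (le_antisymm (nd_le_nd (by omega) hl) h3)
      omega
    have hi : ht I i = k := by
      rcases Nat.eq_zero_or_pos k with rfl | hpos
      · omega
      · have := hlow i (k - 1) (by omega) (by congr 1; omega)
        omega
    refine ⟨hi, ?_⟩
    rintro (h | ⟨h, hne⟩)
    · omega
    · have hka : k = a := by omega
      have := hlow (mx i) (a - 1) (by omega) (by rw [hka, nd_mx]; congr 1; omega)
      omega
  · rintro ⟨hi, hf⟩
    have hf' : ht I i ≤ a ∧ (ht I i = a → ht I (mx i) = a) := by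
      unfold Falls at hf
      refine ⟨by omega, fun h => ?_⟩
      by_contra hn
      exact hf (Or.inr ⟨h, hn⟩)
    refine ⟨show _ ∉ I by rw [nd_mem_iff I hk]; omega, ?_⟩
    intro y hy hle
    obtain ⟨j, l, m, hlm, hm, rfl, he⟩ := le_iff.1 hle
    rw [nd_mem_iff I (by omega)] at hy
    obtain ⟨rfl, hj⟩ := (nd_eq_nd hk hm).1 he
    rcases Nat.lt_or_eq_of_le hlm with hlt | rfl
    · exfalso
      rcases hj with rfl | ⟨rfl, rfl⟩ | ⟨rfl, rfl⟩ <;> omega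
    · exact he.le

/-- A chain that does not fall carries a generator at height `ht I i`. A falling chain carries none
and keeps at most its minimum, which it can get only from its neighbour `mn i`. -/
theorem ht_step (I : LowerSet (Fence a ha)) : ht (step I) = rot a (ht I) := by
  have hv := valid_ht I
  refine ht_unique (fun i => ?_) fun i k hk => ?_
  · have := hv i
    unfold rot
    split_ifs with h1 h2
    · omega
    · omega
    · unfold Falls at h1
      omega
  · have : nd ha i k ∈ step I ↔
        (k ≤ ht I i ∧ ¬ Falls a (ht I) i) ∨ (k = 0 ∧ ¬ Falls a (ht I) (mn i)) := by
      simp only [step, mem_lowerClosure, Set.mem_ofPred_eq]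
      constructor
      · rintro ⟨z, hz, hle⟩
        obtain ⟨j, l, m, hlm, hm, he, rfl⟩ := le_iff.1 hle
        rw [minimal_nd_iff I hm] at hz
        obtain ⟨hz1, hz2⟩ := hz
        obtain ⟨rfl, rfl | ⟨rfl, rfl⟩ | ⟨rfl, rfl⟩⟩ := (nd_eq_nd hk (hlm.trans hm)).1 he
        · exact Or.inl ⟨by omega, hz2⟩
        -- The generator is the shared maximum, named on the other chain; not falling there forces
        -- both heights to be `a`.
        · left
          have h1 := hv i
          have h2 := hv (mx i)
          simp only [Falls, mx_mx] at hz2 ⊢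
          omega
        · exact Or.inr ⟨rfl, hz2⟩
      · have hF : ∀ j, ¬ Falls a (ht I) j → ht I j ≤ a := by
          intro j hj
          have := hv j
          unfold Falls at hj
          omega
        rintro (⟨h1, h2⟩ | ⟨rfl, h2⟩)
        · exact ⟨nd ha i (ht I i), (minimal_nd_iff I (hF i h2)).2 ⟨rfl, h2⟩,
            nd_le_nd h1 (hF i h2)⟩
        · refine ⟨nd ha (mn i) (ht I (mn i)), (minimal_nd_iff I (hF _ h2)).2 ⟨rfl, h2⟩, ?_⟩
          rw [nd_mn]
          exact nd_le_nd (Nat.zero_le _) (hF _ h2)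
    rw [this]
    unfold rot
    split_ifs with h1 h2 <;> simp [h1] <;> first | omega | simp [h2]

theorem valid_rot {h : Fin 4 → ℕ} (ha : 0 < a) (hv : Valid a h) : Valid a (rot a h) := by
  obtain ⟨I, rfl⟩ := exists_ht_eq (ha := ha) hv
  rw [← ht_step]
  exact valid_ht _

theorem ht_rowmotion_iterate (I : LowerSet (Fence a ha)) (k : ℕ) :
    ht ((rowmotion (Fence a ha))^[k] I) = (rot a)^[k] (ht I) := by
  induction k with
  | zero => rfl
  | succ k ih =>
    rw [Function.iterate_succ_apply', Function.iterate_succ_apply', ← ih]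
    exact ht_step _

/-! ### Maximal elements and the two statistics in terms of heights. -/

theorem maximal_nd_iff (I : LowerSet (Fence a ha)) {i : Fin 4} {k : ℕ} (hk : k ≤ a) :
    Maximal (fun y => y ∈ I) (nd ha i k) ↔ ht I i = k + 1 ∧ (k = 0 → ht I (mn i) = 1) := by
  have hv := valid_ht I
  have h1 := hv i
  have h2 := hv (mn i)
  have h3 := hv (mx i)
  constructor
  · rintro ⟨hmem, hmax⟩
    rw [nd_mem_iff I hk] at hmem
    have hup : ∀ j, k + 1 ≤ a → nd ha i k = nd ha j k → ht I j ≤ k + 1 := by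
      intro j hl he
      by_contra! hn
      have h3 := hmax (y := nd ha j (k + 1)) (show _ ∈ I by rwa [nd_mem_iff I hl])
        (he ▸ nd_le_nd (by omega) hl)
      rw [he] at h3
      have h4 := (nd_eq_nd hk hl).1 (le_antisymm (nd_le_nd (by omega) hl) h3)
      omega
    constructor
    · by_cases hka : k + 1 ≤ a
      · have := hup i hka rfl
        omega
      · omega
    · rintro rfl
      have := hup (mn i) ha (nd_mn i)
      omega
  · rintro ⟨hi, h0⟩
    refine ⟨show _ ∈ I by rw [nd_mem_iff I hk]; omega, ?_⟩
    intro y hy hle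
    obtain ⟨j, l, m, hlm, hm, he, rfl⟩ := le_iff.1 hle
    rw [nd_mem_iff I hm] at hy
    obtain ⟨rfl, hj⟩ := (nd_eq_nd hk (hlm.trans hm)).1 he
    rcases Nat.lt_or_eq_of_le hlm with hlt | rfl
    · exfalso
      rcases hj with rfl | ⟨rfl, rfl⟩ | ⟨rfl, rfl⟩ <;> omega
    · exact he.ge

/-- Twice the number of elements on a chain, each shared element counted with weight one half. -/
def sizeWeight (a h : ℕ) : ℤ := if h = 0 then 0 else if h = a + 1 then 2 * a else 2 * h - 1

/-- Twice the contribution of a chain to the number of maximal elements; a shared minimum is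
counted when it is absent instead of when it is maximal. -/
def maxWeight (a h : ℕ) : ℤ := if h = 0 then 1 else if h = 1 then 0 else if h = a + 1 then 1 else 2

/-- The indicator that the minimum of a chain is a maximal element. -/
def bottomMax (h : Fin 4 → ℕ) (i : Fin 4) : ℤ := if h i = 1 ∧ h (mn i) = 1 then 1 else 0

theorem two_mul_card (I : LowerSet (Fence a ha)) [DecidablePred fun v => v ∈ I] :
    2 * ((∑ v : Fence a ha, if v ∈ I then 1 else 0 : ℕ) : ℤ) = ∑ i, sizeWeight a (ht I i) := by
  have e1 : ∀ i, (∑ k ∈ Finset.range a, if nd ha i k ∈ I then 1 else 0) = min (ht I i) a := by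
    intro i
    have h : ∀ k ∈ Finset.range a,
        (if nd ha i k ∈ I then 1 else 0) = if k < ht I i then 1 else 0 := fun k hk =>
      if_congr (nd_mem_iff I (Finset.mem_range.1 hk).le) rfl rfl
    rw [Finset.sum_congr rfl h, ← Finset.card_filter,
      show {k ∈ Finset.range a | k < ht I i} = Finset.range (min (ht I i) a) by
        ext k; simp; omega, Finset.card_range]
  have e2 : ∀ i, (∑ k ∈ Finset.range a, if nd ha i (k + 1) ∈ I then 1 else 0) = ht I i - 1 := by
    intro i
    have h : ∀ k ∈ Finset.range a,
        (if nd ha i (k + 1) ∈ I then 1 else 0) = if k + 1 < ht I i then 1 else 0 := fun k hk =>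
      if_congr (nd_mem_iff I (Finset.mem_range.1 hk)) rfl rfl
    have := ht_le I i
    rw [Finset.sum_congr rfl h, ← Finset.card_filter,
      show {k ∈ Finset.range a | k + 1 < ht I i} = Finset.range (ht I i - 1) by
        ext k; simp; omega, Finset.card_range]
  rw [sum_fence, e1, e2, e1, e2, Fin.sum_univ_four]
  have h0 := valid_ht I 0
  have h1 := valid_ht I 1
  have h2 := valid_ht I 2
  have h3 := valid_ht I 3
  simp only [mx, mn, Matrix.cons_val] at h0 h1 h2 h3
  -- Chains are paired at their maxima. The error terms record empty chains and cancel around the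
  -- cycle, because chains sharing a minimum are empty together.
  have hw : ∀ p q : ℕ, p ≤ a + 1 → q ≤ a + 1 → (p = a + 1 ↔ q = a + 1) →
      2 * ((min p a : ℕ) : ℤ) + 2 * ((q - 1 : ℕ) : ℤ) = sizeWeight a p + sizeWeight a q +
        ((if q = 0 then 1 else 0) - if p = 0 then 1 else 0) := by
    intro p q hp hq hpq
    unfold sizeWeight
    split_ifs <;> omega
  have w1 := hw _ _ h0.1 h1.1 h0.2.2
  have w2 := hw _ _ h2.1 h3.1 h2.2.2
  have c1 : (if ht I 0 = 0 then (1 : ℤ) else 0) = if ht I 3 = 0 then 1 else 0 :=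
    if_congr h0.2.1 rfl rfl
  have c2 : (if ht I 1 = 0 then (1 : ℤ) else 0) = if ht I 2 = 0 then 1 else 0 :=
    if_congr h1.2.1 rfl rfl
  simp only [Nat.cast_add, mul_add]
  linarith

theorem two_mul_card_maximal (I : LowerSet (Fence a ha))
    [DecidablePred fun v => Maximal (fun y => y ∈ I) v] :
    2 * ((∑ v : Fence a ha, if Maximal (fun y => y ∈ I) v then 1 else 0 : ℕ) : ℤ) =
      ∑ i, maxWeight a (ht I i) + ∑ i, bottomMax (ht I) i - ∑ i, (if ht I i = 0 then 1 else 0) := by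
  have e1 : ∀ i, (∑ k ∈ Finset.range a, if Maximal (fun y => y ∈ I) (nd ha i k) then 1 else 0) =
      if 1 ≤ ht I i ∧ ht I i ≤ a ∧ (ht I i = 1 → ht I (mn i) = 1) then 1 else 0 := by
    intro i
    have h : ∀ k ∈ Finset.range a, (if Maximal (fun y => y ∈ I) (nd ha i k) then 1 else 0) =
        if ht I i = k + 1 ∧ (k = 0 → ht I (mn i) = 1) then 1 else 0 := fun k hk =>
      if_congr (maximal_nd_iff I (Finset.mem_range.1 hk).le) rfl rfl
    rw [Finset.sum_congr rfl h]
    split_ifs with h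
    · rw [Finset.sum_eq_single (ht I i - 1)]
      · rw [if_pos]; omega
      · intro k _ hk
        rw [if_neg]; omega
      · intro hk
        simp at hk; omega
    · refine Finset.sum_eq_zero fun k hk => ?_
      simp at hk
      rw [if_neg]; omega
  have e2 : ∀ i, (∑ k ∈ Finset.range a,
      if Maximal (fun y => y ∈ I) (nd ha i (k + 1)) then 1 else 0) =
      if 2 ≤ ht I i then 1 else 0 := by
    intro i
    have := ht_le I i
    have h : ∀ k ∈ Finset.range a, (if Maximal (fun y => y ∈ I) (nd ha i (k + 1)) then 1 else 0) =
        if ht I i = k + 1 + 1 ∧ (k + 1 = 0 → ht I (mn i) = 1) then 1 else 0 := fun k hk =>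
      if_congr (maximal_nd_iff I (Finset.mem_range.1 hk)) rfl rfl
    rw [Finset.sum_congr rfl h]
    split_ifs with h
    · rw [Finset.sum_eq_single (ht I i - 2)]
      · exact if_pos ⟨by omega, fun h => h.elim⟩
      · intro k _ hk
        rw [if_neg]; omega
      · intro hk
        simp at hk; omega
    · refine Finset.sum_eq_zero fun k hk => ?_
      rw [if_neg]; omega
  have e10 : (∑ k ∈ Finset.range a, if Maximal (fun y => y ∈ I) (nd ha 0 k) then 1 else 0) =
      if 1 ≤ ht I 0 ∧ ht I 0 ≤ a ∧ (ht I 0 = 1 → ht I 3 = 1) then 1 else 0 := e1 0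
  have e12 : (∑ k ∈ Finset.range a, if Maximal (fun y => y ∈ I) (nd ha 2 k) then 1 else 0) =
      if 1 ≤ ht I 2 ∧ ht I 2 ≤ a ∧ (ht I 2 = 1 → ht I 1 = 1) then 1 else 0 := e1 2
  have b0 : bottomMax (ht I) 0 = if ht I 0 = 1 ∧ ht I 3 = 1 then 1 else 0 := rfl
  have b1 : bottomMax (ht I) 1 = if ht I 1 = 1 ∧ ht I 2 = 1 then 1 else 0 := rfl
  have b2 : bottomMax (ht I) 2 = if ht I 2 = 1 ∧ ht I 1 = 1 then 1 else 0 := rfl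
  have b3 : bottomMax (ht I) 3 = if ht I 3 = 1 ∧ ht I 0 = 1 then 1 else 0 := rfl
  rw [sum_fence, e10, e2, e12, e2]
  simp only [Fin.sum_univ_four, b0, b1, b2, b3]
  have h0 := valid_ht I 0
  have h1 := valid_ht I 1
  have h2 := valid_ht I 2
  have h3 := valid_ht I 3
  simp only [mx, mn, Matrix.cons_val] at h0 h1 h2 h3
  -- Now chains are paired at their minima, and the error terms, recording full chains, cancel
  -- across the shared maxima.
  have hw : ∀ p s : ℕ, p ≤ a + 1 → s ≤ a + 1 → (p = 0 ↔ s = 0) →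
      2 * ((if 1 ≤ p ∧ p ≤ a ∧ (p = 1 → s = 1) then 1 else 0 : ℕ) : ℤ) +
        2 * ((if 2 ≤ s then 1 else 0 : ℕ) : ℤ) =
      maxWeight a p + maxWeight a s + ((if p = 1 ∧ s = 1 then 1 else 0) +
        (if s = 1 ∧ p = 1 then 1 else 0)) - ((if p = 0 then 1 else 0) + if s = 0 then 1 else 0) +
        ((if s = a + 1 then 1 else 0) - if p = a + 1 then 1 else 0) := by
    intro p s hp hs hps
    unfold maxWeight
    split_ifs <;> omega
  have w1 := hw _ _ h0.1 h3.1 h0.2.1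
  have w2 := hw _ _ h2.1 h1.1 h2.2.1
  have c1 : (if ht I 0 = a + 1 then (1 : ℤ) else 0) = if ht I 1 = a + 1 then 1 else 0 :=
    if_congr h0.2.2 rfl rfl
  have c2 : (if ht I 2 = a + 1 then (1 : ℤ) else 0) = if ht I 3 = a + 1 then 1 else 0 :=
    if_congr h2.2.2 rfl rfl
  simp only [Nat.cast_add, mul_add]
  linarith

/-- A shared minimum is a maximal element right after it was absent, and only then. So over a period
the non-local term `bottomMax` may be traded for the indicator of height `0`. -/
theorem bottomMax_rot (ha : 0 < a) {h : Fin 4 → ℕ} (hv : Valid a h) (i : Fin 4) :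
    bottomMax (rot a h) i = if h i = 0 then 1 else 0 := by
  have h1 := hv i
  have h2 := hv (mn i)
  unfold bottomMax rot
  rw [mn_mn] at *
  by_cases f1 : Falls a h i <;> by_cases f2 : Falls a h (mn i) <;>
    simp only [f1, f2, if_true, if_false] <;>
    unfold Falls at f1 f2 <;> split_ifs <;> first | omega | simp_all

end FourFence

/-! ### Cyclic counters -/

namespace FourFence

/-- The cyclic counter on `{lo, …, hi}`. -/
def nx (lo hi h : ℕ) : ℕ := if h = hi then lo else h + 1

section Counter

variable {lo hi u v : ℕ}

theorem nx_mem (hle : lo ≤ hi) (h : lo ≤ u ∧ u ≤ hi) : lo ≤ nx lo hi u ∧ nx lo hi u ≤ hi := by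
  unfold nx
  split_ifs <;> omega

theorem nx_eq_nx (hu : lo ≤ u ∧ u ≤ hi) (hv : lo ≤ v ∧ v ≤ hi) :
    nx lo hi u = nx lo hi v ↔ u = v := by
  unfold nx
  split_ifs <;> omega

theorem nx_iterate_mem (hle : lo ≤ hi) (h : lo ≤ u ∧ u ≤ hi) (k : ℕ) :
    lo ≤ (nx lo hi)^[k] u ∧ (nx lo hi)^[k] u ≤ hi := by
  induction k with
  | zero => exact h
  | succ k ih => rw [Function.iterate_succ_apply']; exact nx_mem hle ih

theorem nx_iterate_eq (hu : lo ≤ u ∧ u ≤ hi) (hv : lo ≤ v ∧ v ≤ hi) (k : ℕ) :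
    (nx lo hi)^[k] u = (nx lo hi)^[k] v ↔ u = v := by
  have hle : lo ≤ hi := hu.1.trans hu.2
  induction k with
  | zero => rfl
  | succ k ih =>
    rw [Function.iterate_succ_apply', Function.iterate_succ_apply']
    exact (nx_eq_nx (nx_iterate_mem hle hu k) (nx_iterate_mem hle hv k)).trans ih

theorem nx_iterate_of_le {k : ℕ} (h : u + k ≤ hi) : (nx lo hi)^[k] u = u + k := by
  induction k with
  | zero => rfl
  | succ k ih =>
    rw [Function.iterate_succ_apply', ih (by omega), nx, if_neg (by omega), add_assoc]

theorem nx_iterate_period (h : lo ≤ u ∧ u ≤ hi) : (nx lo hi)^[hi + 1 - lo] u = u := by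
  obtain ⟨d, rfl⟩ := Nat.exists_eq_add_of_le h.1
  have h1 : (nx lo hi)^[d] lo = lo + d := nx_iterate_of_le h.2
  have h2 : (nx lo hi)^[hi + 1 - lo] lo = lo := by
    rw [show hi + 1 - lo = (hi - lo) + 1 by omega, Function.iterate_succ_apply',
      nx_iterate_of_le (by omega), nx, if_pos (by omega)]
  rw [← h1, ← Function.iterate_add_apply, add_comm, Function.iterate_add_apply, h2]

theorem exists_nx_iterate_eq (h : lo ≤ u ∧ u ≤ hi) : ∃ k, (nx lo hi)^[k] u = lo := by
  refine ⟨hi - u + 1, ?_⟩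
  rw [Function.iterate_succ_apply', nx_iterate_of_le (by omega), nx, if_pos (by omega)]

/-- Moving the start by one drops a term and appends an equal one, by periodicity; so the start may
be taken to be `lo`. -/
theorem sum_nx_iterate (φ : ℕ → ℤ) (h : lo ≤ u ∧ u ≤ hi) :
    ∑ k ∈ Finset.range (hi + 1 - lo), φ ((nx lo hi)^[k] u) =
      ∑ k ∈ Finset.range (hi + 1 - lo), φ (lo + k) := by
  obtain ⟨d, rfl⟩ := Nat.exists_eq_add_of_le h.1
  induction d with
  | zero =>
    refine Finset.sum_congr rfl fun k hk => ?_
    rw [Finset.mem_range] at hk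
    rw [nx_iterate_of_le (by omega), add_zero]
  | succ d ih =>
    rw [← ih ⟨by omega, by omega⟩]
    have h1 : nx lo hi (lo + d) = lo + (d + 1) := by
      rw [nx, if_neg (by omega)]; rfl
    rw [← h1]
    simp only [← Function.iterate_succ_apply]
    have h2 := Finset.sum_range_succ (fun k => φ ((nx lo hi)^[k] (lo + d))) (hi + 1 - lo)
    rw [Finset.sum_range_succ', nx_iterate_period ⟨by omega, by omega⟩] at h2
    simpa using h2

end Counter

/-! ### Paths of height vectors -/

variable {a : ℕ}

/-- Sum of a chainwise weight over the first `n` rowmotion steps. -/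
def pathSum (a : ℕ) (φ : ℕ → ℤ) (n : ℕ) (s : Fin 4 → ℕ) : ℤ :=
  ∑ k ∈ Finset.range n, ∑ i, φ ((rot a)^[k] s i)

/-- Rowmotion leads from `s` to `s'` in `n` steps, with the given weight sums. -/
def Path (a n : ℕ) (s s' : Fin 4 → ℕ) (σ : (ℕ → ℤ) → ℤ) : Prop :=
  (rot a)^[n] s = s' ∧ ∀ φ, pathSum a φ n s = σ φ

theorem pathSum_add (φ : ℕ → ℤ) (m n : ℕ) (s : Fin 4 → ℕ) :
    pathSum a φ (m + n) s = pathSum a φ m s + pathSum a φ n ((rot a)^[m] s) := by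
  unfold pathSum
  rw [Finset.sum_range_add]
  simp only [← Function.iterate_add_apply, add_comm]

theorem Path.trans {m n : ℕ} {s s' s'' : Fin 4 → ℕ} {σ τ : (ℕ → ℤ) → ℤ}
    (h : Path a m s s' σ) (h' : Path a n s' s'' τ) : Path a (m + n) s s'' (fun φ => σ φ + τ φ) := by
  refine ⟨?_, fun φ => ?_⟩
  · rw [add_comm, Function.iterate_add_apply, h.1, h'.1]
  · rw [pathSum_add, h.1, h.2, h'.2]

theorem Path.refl (s : Fin 4 → ℕ) : Path a 0 s s fun _ => 0 := ⟨rfl, fun _ => rfl⟩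

theorem Path.single {s s' : Fin 4 → ℕ} (h : rot a s = s') : Path a 1 s s' fun φ => ∑ i, φ (s i) :=
  ⟨h, fun φ => by simp [pathSum]⟩

/-- Independent cyclic counters on the four chains. -/
def adv (lo hi s : Fin 4 → ℕ) (i : Fin 4) : ℕ := nx (lo i) (hi i) (s i)

theorem adv_iterate (lo hi s : Fin 4 → ℕ) (k : ℕ) (i : Fin 4) :
    (adv lo hi)^[k] s i = (nx (lo i) (hi i))^[k] (s i) := by
  induction k with
  | zero => rfl
  | succ k ih => rw [Function.iterate_succ_apply', Function.iterate_succ_apply', adv, ih]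

/-- The interaction of the chains is confined to two questions: at which height a chain falls, and
whether it lands at `0` or `1`. -/
theorem rot_eq_adv {lo hi s : Fin 4 → ℕ} (hF : ∀ i, Falls a s i ↔ s i = hi i)
    (hlo : ∀ i, s i = hi i →
      lo i = 0 ∧ s (mn i) = hi (mn i) ∨ lo i = 1 ∧ s (mn i) ≠ hi (mn i)) :
    rot a s = adv lo hi s := by
  funext i
  simp only [rot, adv, nx, hF]
  split_ifs with h1 h2
  · have := hlo i h1
    omega
  · have := hlo i h1
    omega
  · rfl

theorem Path.of_adv {lo hi s : Fin 4 → ℕ} {n : ℕ}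
    (h : ∀ k < n, rot a ((adv lo hi)^[k] s) = adv lo hi ((adv lo hi)^[k] s)) :
    Path a n s (fun i => (nx (lo i) (hi i))^[n] (s i))
      fun φ => ∑ i, ∑ k ∈ Finset.range n, φ ((nx (lo i) (hi i))^[k] (s i)) := by
  have hk : ∀ k ≤ n, (rot a)^[k] s = (adv lo hi)^[k] s := by
    intro k hk
    induction k with
    | zero => rfl
    | succ k ih =>
      rw [Function.iterate_succ_apply', Function.iterate_succ_apply', ih (by omega), h k hk]
  refine ⟨?_, fun φ => ?_⟩
  · rw [hk n le_rfl]
    funext i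
    rw [adv_iterate]
  · rw [pathSum, Finset.sum_comm]
    refine Finset.sum_congr rfl fun i _ => Finset.sum_congr rfl fun k hkn => ?_
    rw [hk k (Finset.mem_range.1 hkn).le, adv_iterate]

/-! ### States in which all chains move with the same period -/

/-- All four chains run through `{lo, …, hi}`, and neighbouring chains are synchronous exactly
where the range is extended. -/
def Tame (a lo hi : ℕ) (s : Fin 4 → ℕ) : Prop :=
  ∀ i, (lo ≤ s i ∧ s i ≤ hi) ∧ (s (mn i) = s i ↔ lo = 0) ∧ (s (mx i) = s i ↔ hi = a + 1)

section Tame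

variable {lo hi : ℕ} {s : Fin 4 → ℕ}

/-- Synchrony at maxima lets every chain climb to `a + 1`, and its absence makes every chain fall at
`a`; synchrony at minima decides in the same way between landing at `0` and at `1`. -/
theorem Tame.rot_eq (hlo : lo ≤ 1) (hhi : hi = a ∨ hi = a + 1) (h : Tame a lo hi s) :
    rot a s = adv (fun _ => lo) (fun _ => hi) s := by
  refine rot_eq_adv (fun i => ?_) fun i hi' => ?_
  · have := h i
    unfold Falls
    omega
  · have := h i
    omega

theorem Tame.adv (hle : lo ≤ hi) (h : Tame a lo hi s) :
    Tame a lo hi (adv (fun _ => lo) (fun _ => hi) s) := by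
  intro i
  refine ⟨nx_mem hle (h i).1, ?_, ?_⟩
  · rw [← (h i).2.1]
    exact nx_eq_nx (h _).1 (h _).1
  · rw [← (h i).2.2]
    exact nx_eq_nx (h _).1 (h _).1

theorem Tame.adv_iterate (hle : lo ≤ hi) (h : Tame a lo hi s) (k : ℕ) :
    Tame a lo hi ((FourFence.adv (fun _ => lo) (fun _ => hi))^[k] s) := by
  induction k with
  | zero => exact h
  | succ k ih => rw [Function.iterate_succ_apply']; exact ih.adv hle

theorem Tame.path (hlo : lo ≤ 1) (hhi : hi = a ∨ hi = a + 1) (hle : lo ≤ hi)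
    (h : Tame a lo hi s) (n : ℕ) :
    Path a n s (fun i => (nx lo hi)^[n] (s i))
      fun φ => ∑ i, ∑ k ∈ Finset.range n, φ ((nx lo hi)^[k] (s i)) :=
  Path.of_adv (lo := fun _ => lo) (hi := fun _ => hi) fun k _ =>
    (h.adv_iterate hle k).rot_eq hlo hhi

theorem Tame.path_period (hlo : lo ≤ 1) (hhi : hi = a ∨ hi = a + 1) (hle : lo ≤ hi)
    (h : Tame a lo hi s) :
    Path a (hi + 1 - lo) s s fun φ => 4 * ∑ k ∈ Finset.range (hi + 1 - lo), φ (lo + k) := by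
  have hp := h.path hlo hhi hle (hi + 1 - lo)
  refine ⟨?_, fun φ => ?_⟩
  · rw [hp.1]
    funext i
    exact nx_iterate_period (h i).1
  · refine (hp.2 φ).trans ?_
    beta_reduce
    rw [Finset.sum_congr rfl fun i _ => sum_nx_iterate φ (h i).1]
    simp

theorem Tame.exists_iterate (hlo : lo ≤ 1) (hhi : hi = a ∨ hi = a + 1) (hle : lo ≤ hi)
    (h : Tame a lo hi s) : ∃ k, Tame a lo hi ((rot a)^[k] s) ∧ (rot a)^[k] s 0 = lo := by
  obtain ⟨k, hk⟩ := exists_nx_iterate_eq (h 0).1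
  have hp := (h.path hlo hhi hle k).1
  refine ⟨k, ?_, ?_⟩
  · have := h.adv_iterate hle k
    convert this using 1
    rw [hp]
    funext i
    rw [FourFence.adv_iterate]
  · rw [hp]
    exact hk

end Tame

/-! ### Symmetries -/

/-- The symmetries of the system of chains. -/
structure Sym (π : Fin 4 → Fin 4) : Prop where
  bij : Function.Bijective π
  mx : ∀ i, π (mx i) = FourFence.mx (π i)
  mn : ∀ i, π (mn i) = FourFence.mn (π i)

/-- The half turn. -/
def half : Fin 4 → Fin 4 := ![2, 3, 0, 1]

theorem sym_id : Sym id := ⟨Function.bijective_id, fun _ => rfl, fun _ => rfl⟩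
theorem sym_mx : Sym mx := ⟨by decide, by decide, by decide⟩
theorem sym_mn : Sym mn := ⟨by decide, by decide, by decide⟩
theorem sym_half : Sym half := ⟨by decide, by decide, by decide⟩

section Sym

variable {π ρ : Fin 4 → Fin 4}

theorem Sym.comp (hπ : Sym π) (hρ : Sym ρ) : Sym (π ∘ ρ) where
  bij := hπ.bij.comp hρ.bij
  mx i := by simp only [Function.comp_apply, hρ.mx, hπ.mx]
  mn i := by simp only [Function.comp_apply, hρ.mn, hπ.mn]

/-- A symmetry is determined by the image of `0`, since `mx` and `mn` act transitively. -/
theorem Sym.cases (hπ : Sym π) : π = id ∨ π = FourFence.mx ∨ π = FourFence.mn ∨ π = half := by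
  have h1 : π 1 = FourFence.mx (π 0) := hπ.mx 0
  have h3 : π 3 = FourFence.mn (π 0) := hπ.mn 0
  have h2 : π 2 = FourFence.mn (FourFence.mx (π 0)) := by rw [← hπ.mx, ← hπ.mn]; rfl
  have : ∀ c : Fin 4, c = 0 ∨ c = 1 ∨ c = 3 ∨ c = 2 := by decide
  rcases this (π 0) with h | h | h | h <;> rw [h] at h1 h2 h3
  · left; funext i; fin_cases i <;> simp [h, h1, h2, h3] <;> rfl
  · right; left; funext i; fin_cases i <;> simp [h, h1, h2, h3] <;> rfl
  · right; right; left; funext i; fin_cases i <;> simp [h, h1, h2, h3] <;> rfl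
  · right; right; right; funext i; fin_cases i <;> simp [h, h1, h2, h3] <;> rfl

theorem falls_comp (hπ : Sym π) (s : Fin 4 → ℕ) (i : Fin 4) :
    Falls a (s ∘ π) i ↔ Falls a s (π i) := by
  simp [Falls, hπ.mx]

theorem rot_comp (hπ : Sym π) (s : Fin 4 → ℕ) : rot a (s ∘ π) = rot a s ∘ π := by
  funext i
  simp [rot, falls_comp hπ, hπ.mn]

theorem rot_iterate_comp (hπ : Sym π) (s : Fin 4 → ℕ) (k : ℕ) :
    (rot a)^[k] (s ∘ π) = (rot a)^[k] s ∘ π := by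
  induction k with
  | zero => rfl
  | succ k ih => rw [Function.iterate_succ_apply', Function.iterate_succ_apply', ih, rot_comp hπ]

theorem Path.comp (hπ : Sym π) {n : ℕ} {s s' : Fin 4 → ℕ} {σ : (ℕ → ℤ) → ℤ}
    (h : Path a n s s' σ) : Path a n (s ∘ π) (s' ∘ π) σ := by
  refine ⟨by rw [rot_iterate_comp hπ, h.1], fun φ => ?_⟩
  rw [← h.2]
  refine Finset.sum_congr rfl fun k _ => ?_
  rw [rot_iterate_comp hπ]
  exact hπ.bij.sum_comp fun i => φ ((rot a)^[k] s i)

theorem valid_comp (hπ : Sym π) {s : Fin 4 → ℕ} (h : Valid a s) : Valid a (s ∘ π) := by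
  intro i
  simpa [hπ.mx, hπ.mn] using h (π i)

theorem tame_comp (hπ : Sym π) {lo hi : ℕ} {s : Fin 4 → ℕ} (h : Tame a lo hi s) :
    Tame a lo hi (s ∘ π) := by
  intro i
  simpa [hπ.mx, hπ.mn] using h (π i)

end Sym

/-! ### States in which a synchronous pair is overtaken by the other chains -/

theorem rot_vec (p q r s p' q' r' s' : ℕ)
    (h0 : p' = if p = a + 1 ∨ p = a ∧ q ≠ a then
      (if s = a + 1 ∨ s = a ∧ r ≠ a then 0 else 1) else p + 1)
    (h1 : q' = if q = a + 1 ∨ q = a ∧ p ≠ a then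
      (if r = a + 1 ∨ r = a ∧ s ≠ a then 0 else 1) else q + 1)
    (h2 : r' = if r = a + 1 ∨ r = a ∧ s ≠ a then
      (if q = a + 1 ∨ q = a ∧ p ≠ a then 0 else 1) else r + 1)
    (h3 : s' = if s = a + 1 ∨ s = a ∧ r ≠ a then
      (if p = a + 1 ∨ p = a ∧ q ≠ a then 0 else 1) else s + 1) :
    rot a ![p, q, r, s] = ![p', q', r', s'] := by
  funext i
  fin_cases i
  · exact h0.symm
  · exact h1.symm
  · exact h2.symm
  · exact h3.symm

/-- The weight sum over the interior of a chain. -/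
def inner (a : ℕ) (φ : ℕ → ℤ) : ℤ := ∑ k ∈ Finset.range a, φ (1 + k)

/-- The pair `0, 3` climbs once from `0` to `a`, meanwhile chains `1` and `2` complete a full cycle
of length `a`; as they never agree, each falls alone from `a` to `1`. -/
theorem path_min {u v : ℕ} (hu : 1 ≤ u ∧ u ≤ a) (hv : 1 ≤ v ∧ v ≤ a) (huv : u ≠ v) :
    Path a a ![0, u, v, 0] ![a, u, v, a]
      fun φ => 2 * ∑ k ∈ Finset.range a, φ k + 2 * inner a φ := by
  have hle : 1 ≤ a := hu.1.trans hu.2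
  have hp := Path.of_adv (a := a) (n := a) (lo := ![0, 1, 1, 0]) (hi := fun _ => a)
    (s := ![0, u, v, 0]) fun k hk => by
      have e0 := adv_iterate ![0, 1, 1, 0] (fun _ => a) ![0, u, v, 0] k
      have hc := nx_iterate_mem hle hu k
      have hd := nx_iterate_mem hle hv k
      have hcd := (nx_iterate_eq hu hv k).not.2 huv
      have h0 : (nx 0 a)^[k] 0 = k := by rw [nx_iterate_of_le (by omega), zero_add]
      have e : (adv ![0, 1, 1, 0] fun _ => a)^[k] ![0, u, v, 0] =
          ![k, (nx 1 a)^[k] u, (nx 1 a)^[k] v, k] := by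
        funext i
        rw [e0]
        fin_cases i <;> simp [h0]
      rw [e]
      generalize (nx 1 a)^[k] u = c at *
      generalize (nx 1 a)^[k] v = d at *
      refine rot_eq_adv (fun i => ?_) fun i => ?_
      · fin_cases i <;> simp [Falls, mx] <;> omega
      · fin_cases i <;> simp [mn] <;> omega
  have hsum : ∀ (φ : ℕ → ℤ) w, 1 ≤ w ∧ w ≤ a →
      ∑ k ∈ Finset.range a, φ ((nx 1 a)^[k] w) = inner a φ := by
    intro φ w hw
    simpa [inner] using sum_nx_iterate φ hw
  have h0 : ∀ φ : ℕ → ℤ, ∑ k ∈ Finset.range a, φ ((nx 0 a)^[k] 0) = ∑ k ∈ Finset.range a, φ k :=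
    fun φ => Finset.sum_congr rfl fun k hk => by
      rw [nx_iterate_of_le (by simp at hk; omega), zero_add]
  have hper : ∀ w, 1 ≤ w ∧ w ≤ a → (nx 1 a)^[a] w = w := fun w hw => by
    simpa using nx_iterate_period hw
  refine ⟨?_, fun φ => ?_⟩
  · rw [hp.1]
    funext i
    fin_cases i <;> simp [hper _ hu, hper _ hv, nx_iterate_of_le]
  · refine (hp.2 φ).trans ?_
    beta_reduce
    rw [Fin.sum_univ_four]
    simp [h0, hsum _ _ hu, hsum _ _ hv]
    ring

/-- The pair `0, 1` passes `a` together and so climbs on to `a + 1`, while the other two chains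
complete one cycle. -/
theorem path_max {u v : ℕ} (hu : 1 ≤ u ∧ u ≤ a) (hv : 1 ≤ v ∧ v ≤ a) (huv : u ≠ v) :
    Path a a ![1, 1, u, v] ![a + 1, a + 1, u, v] fun φ => 4 * inner a φ := by
  have hle : 1 ≤ a := hu.1.trans hu.2
  have hp := Path.of_adv (a := a) (n := a) (lo := fun _ => 1) (hi := ![a + 1, a + 1, a, a])
    (s := ![1, 1, u, v]) fun k hk => by
      have e0 := adv_iterate (fun _ => 1) ![a + 1, a + 1, a, a] ![1, 1, u, v] k
      have hc := nx_iterate_mem hle hu k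
      have hd := nx_iterate_mem hle hv k
      have hcd := (nx_iterate_eq hu hv k).not.2 huv
      have h0 : (nx 1 (a + 1))^[k] 1 = 1 + k := nx_iterate_of_le (by omega)
      have e : (adv (fun _ => 1) ![a + 1, a + 1, a, a])^[k] ![1, 1, u, v] =
          ![1 + k, 1 + k, (nx 1 a)^[k] u, (nx 1 a)^[k] v] := by
        funext i
        rw [e0]
        fin_cases i <;> simp [h0]
      rw [e]
      generalize (nx 1 a)^[k] u = c at *
      generalize (nx 1 a)^[k] v = d at *
      refine rot_eq_adv (fun i => ?_) fun i => ?_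
      · fin_cases i <;> simp [Falls, mx] <;> omega
      · fin_cases i <;> simp [mn] <;> omega
  have hsum : ∀ (φ : ℕ → ℤ) w, 1 ≤ w ∧ w ≤ a →
      ∑ k ∈ Finset.range a, φ ((nx 1 a)^[k] w) = inner a φ := by
    intro φ w hw
    simpa [inner] using sum_nx_iterate φ hw
  have h0 : ∀ φ : ℕ → ℤ, ∑ k ∈ Finset.range a, φ ((nx 1 (a + 1))^[k] 1) = inner a φ :=
    fun φ => Finset.sum_congr rfl fun k hk => by
      rw [nx_iterate_of_le (by simp at hk; omega)]
  have hper : ∀ w, 1 ≤ w ∧ w ≤ a → (nx 1 a)^[a] w = w := fun w hw => by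
    simpa using nx_iterate_period hw
  refine ⟨?_, fun φ => ?_⟩
  · rw [hp.1]
    funext i
    fin_cases i <;> simp [hper _ hu, hper _ hv, nx_iterate_of_le, add_comm]
  · refine (hp.2 φ).trans ?_
    beta_reduce
    rw [Fin.sum_univ_four]
    simp [h0, hsum _ _ hu, hsum _ _ hv]
    ring

theorem Path.congr {n m : ℕ} {s s' : Fin 4 → ℕ} {σ τ : (ℕ → ℤ) → ℤ} (h : Path a n s s' σ)
    (hnm : n = m) (hστ : ∀ φ, σ φ = τ φ) : Path a m s s' τ :=
  hnm ▸ ⟨h.1, fun φ => (h.2 φ).trans (hστ φ)⟩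

theorem sum_range_eq_inner (φ : ℕ → ℤ) : ∑ k ∈ Finset.range a, φ k + φ a = φ 0 + inner a φ := by
  rw [← Finset.sum_range_succ, Finset.sum_range_succ', inner, add_comm]
  simp only [add_comm]

/-- After `path_min` the pair falls from `a` to `0` in one extra step, during which the other chains
each gain one. -/
theorem path_min_round {u v : ℕ} (hu : 1 ≤ u ∧ u < a) (hv : 1 ≤ v ∧ v < a) (huv : u ≠ v) :
    Path a (a + 1) ![0, u, v, 0] ![0, u + 1, v + 1, 0]
      fun φ => 4 * inner a φ + 2 * φ 0 + φ u + φ v := by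
  refine ((path_min ⟨hu.1, hu.2.le⟩ ⟨hv.1, hv.2.le⟩ huv).trans (Path.single (rot_vec _ _ _ _
    0 (u + 1) (v + 1) 0 ?_ ?_ ?_ ?_))).congr rfl fun φ => ?_
  · split_ifs <;> omega
  · split_ifs <;> omega
  · split_ifs <;> omega
  · split_ifs <;> omega
  · have := sum_range_eq_inner (a := a) φ
    simp only [Fin.sum_univ_four, Matrix.cons_val]
    linarith

/-- Chain `2` is at `a` together with chain `3`, so these two rise to their shared maximum, while
chain `0` falls alone. The synchronous pair changes from `0, 3` to `2, 3`. -/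
theorem path_min_to_max {u : ℕ} (hu : 1 ≤ u ∧ u < a) :
    Path a (a + 1) ![0, u, a, 0] ![1, u + 1, a + 1, a + 1]
      fun φ => 4 * inner a φ + 2 * φ 0 + φ u + φ a := by
  refine ((path_min ⟨hu.1, hu.2.le⟩ ⟨by omega, le_rfl⟩ hu.2.ne).trans (Path.single (rot_vec _ _ _ _
    1 (u + 1) (a + 1) (a + 1) ?_ ?_ ?_ ?_))).congr rfl fun φ => ?_
  · split_ifs <;> omega
  · split_ifs <;> omega
  · split_ifs <;> omega
  · split_ifs <;> omega
  · have := sum_range_eq_inner (a := a) φ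
    simp only [Fin.sum_univ_four, Matrix.cons_val]
    linarith

theorem path_max_round {u v : ℕ} (hu : 1 ≤ u ∧ u < a) (hv : 1 ≤ v ∧ v < a) (huv : u ≠ v) :
    Path a (a + 1) ![a + 1, a + 1, u, v] ![a + 1, a + 1, u + 1, v + 1]
      fun φ => 4 * inner a φ + 2 * φ (a + 1) + φ u + φ v := by
  refine ((Path.single (rot_vec (a + 1) (a + 1) u v 1 1 (u + 1) (v + 1) ?_ ?_ ?_ ?_)).trans
    (path_max ⟨by omega, hu.2⟩ ⟨by omega, hv.2⟩ (by omega))).congr (add_comm _ _) fun φ => ?_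
  · split_ifs <;> omega
  · split_ifs <;> omega
  · split_ifs <;> omega
  · split_ifs <;> omega
  · simp only [Fin.sum_univ_four, Matrix.cons_val]
    ring

theorem path_min_rounds {u v : ℕ} (hu : 1 ≤ u) (hv : 1 ≤ v) (huv : u ≠ v) (n : ℕ)
    (hun : u + n ≤ a) (hvn : v + n ≤ a) :
    Path a (n * (a + 1)) ![0, u, v, 0] ![0, u + n, v + n, 0]
      fun φ => n * (4 * inner a φ + 2 * φ 0) +
        (∑ j ∈ Finset.range n, φ (u + j) + ∑ j ∈ Finset.range n, φ (v + j)) := by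
  induction n with
  | zero => exact (Path.refl _).congr (by simp) (by simp)
  | succ n ih =>
    refine ((ih (by omega) (by omega)).trans (path_min_round (u := u + n) (v := v + n)
      ⟨by omega, by omega⟩ ⟨by omega, by omega⟩ (by omega))).congr (by ring) fun φ => ?_
    rw [Finset.sum_range_succ, Finset.sum_range_succ]
    push_cast
    ring

theorem path_max_rounds {u v : ℕ} (hu : 1 ≤ u) (hv : 1 ≤ v) (huv : u ≠ v) (n : ℕ)
    (hun : u + n ≤ a) (hvn : v + n ≤ a) :
    Path a (n * (a + 1)) ![a + 1, a + 1, u, v] ![a + 1, a + 1, u + n, v + n]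
      fun φ => n * (4 * inner a φ + 2 * φ (a + 1)) +
        (∑ j ∈ Finset.range n, φ (u + j) + ∑ j ∈ Finset.range n, φ (v + j)) := by
  induction n with
  | zero => exact (Path.refl _).congr (by simp) (by simp)
  | succ n ih =>
    refine ((ih (by omega) (by omega)).trans (path_max_round (u := u + n) (v := v + n)
      ⟨by omega, by omega⟩ ⟨by omega, by omega⟩ (by omega))).congr (by ring) fun φ => ?_
    rw [Finset.sum_range_succ, Finset.sum_range_succ]
    push_cast
    ring

/-- The state in which the synchronous pair of the first two chains is about to be replaced by
the pair of the first and the last chain. -/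
def swap (a x : ℕ) : Fin 4 → ℕ := ![a + 1, a + 1, x, a]

theorem path_swap_half {x : ℕ} (hx : 1 ≤ x ∧ x < a) :
    Path a (a ^ 2) (swap a x) (swap a x ∘ half)
      fun φ => (4 * a - 2) * inner a φ + 2 * (a - x) * φ 0 + 2 * x * φ (a + 1) := by
  -- Here `y = x - 1` and `z = a - 1 - x` count the plain rounds with a pair at a maximum and at a
  -- minimum. The length is `1 + (z + 1 + y) * (a + 1) = 1 + (a - 1) * (a + 1) = a ^ 2`.
  obtain ⟨y, rfl⟩ : ∃ y, x = 1 + y := Nat.exists_eq_add_of_le hx.1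
  obtain ⟨z, rfl⟩ : ∃ z, a = 1 + y + 1 + z := Nat.exists_eq_add_of_le hx.2
  set a := 1 + y + 1 + z with ha
  have p1 : Path a 1 (swap a (1 + y)) ![0, 1, 1 + y + 1, 0] _ :=
    Path.single (rot_vec _ _ _ _ _ _ _ _ (by split_ifs <;> omega) (by split_ifs <;> omega)
      (by split_ifs <;> omega) (by split_ifs <;> omega))
  have p2 := path_min_rounds (a := a) (u := 1) (v := 1 + y + 1) le_rfl (by omega) (by omega) z
    (by omega) (by omega)
  have p3 := path_min_to_max (a := a) (u := 1 + z) ⟨by omega, by omega⟩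
  have p4 := (path_max_rounds (a := a) (u := 1) (v := 1 + z + 1) le_rfl (by omega) (by omega) y
    (by omega) (by omega)).comp sym_half
  have e3 : (![a + 1, a + 1, 1, 1 + z + 1] : Fin 4 → ℕ) ∘ half = ![1, 1 + z + 1, a + 1, a + 1] := by
    funext i; fin_cases i <;> rfl
  have e4 : 1 + z + 1 + y = a := by omega
  rw [e3, e4] at p4
  rw [← ha] at p2
  refine (((p1.trans p2).trans p3).trans p4).congr ?_ fun φ => ?_
  · rw [ha]; ring
  -- The single terms left over by the four legs run through `1, …, a` exactly twice, apart from
  -- those at `0` and `a + 1`; `s1` and `s2` are the two runs.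
  · have s1 : inner a φ = ∑ j ∈ Finset.range z, φ (1 + j) + φ (1 + z) +
        ∑ j ∈ Finset.range y, φ (1 + z + 1 + j) + φ a := by
      rw [inner, show a = z + 1 + y + 1 by omega, Finset.sum_range_succ, Finset.sum_range_add,
        Finset.sum_range_succ]
      rw [show 1 + (z + 1 + y) = z + 1 + y + 1 by omega]
      congr 2
      refine Finset.sum_congr rfl fun j _ => ?_
      congr 1
      omega
    have s2 : inner a φ = ∑ j ∈ Finset.range y, φ (1 + j) + φ (1 + y) +
        ∑ j ∈ Finset.range z, φ (1 + y + 1 + j) + φ a := by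
      rw [inner, show a = y + 1 + z + 1 by omega, Finset.sum_range_succ, Finset.sum_range_add,
        Finset.sum_range_succ]
      rw [show 1 + (y + 1 + z) = y + 1 + z + 1 by omega]
      congr 2
      refine Finset.sum_congr rfl fun j _ => ?_
      congr 1
      omega
    have ea : (a : ℤ) = 1 + y + 1 + z := by rw [ha]; push_cast; ring
    simp only [Fin.sum_univ_four, Matrix.cons_val, swap]
    rw [ea]
    push_cast
    linear_combination (-1 : ℤ) * s1 - s2

theorem path_swap {x : ℕ} (hx : 1 ≤ x ∧ x < a) :
    Path a (2 * a ^ 2) (swap a x) (swap a x)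
      fun φ => 2 * ((4 * a - 2) * inner a φ + 2 * (a - x) * φ 0 + 2 * x * φ (a + 1)) := by
  have h := (path_swap_half hx).trans ((path_swap_half hx).comp sym_half)
  have e : (swap a x ∘ half) ∘ half = swap a x := by funext i; fin_cases i <;> rfl
  rw [e] at h
  exact h.congr (by ring) fun φ => by ring

end FourFence

/-! ### Every state flows into a periodic representative -/

namespace FourFence

variable {a : ℕ}

/-- The states from which the representatives of the orbits are chosen. -/
def Good (a : ℕ) (s : Fin 4 → ℕ) : Prop :=
  (∃ lo hi, lo ≤ 1 ∧ (hi = a ∨ hi = a + 1) ∧ Tame a lo hi s) ∨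
    ∃ x π, (1 ≤ x ∧ x < a) ∧ Sym π ∧ s = swap a x ∘ π

/-- Rowmotion leads from `s` to a good state. -/
def ReachesGood (a : ℕ) (s : Fin 4 → ℕ) : Prop := ∃ k, Good a ((rot a)^[k] s)

theorem Good.comp {s : Fin 4 → ℕ} {π : Fin 4 → Fin 4} (hπ : Sym π) (h : Good a s) :
    Good a (s ∘ π) := by
  rcases h with ⟨lo, hi, h1, h2, h3⟩ | ⟨x, ρ, hx, hρ, rfl⟩
  · exact Or.inl ⟨lo, hi, h1, h2, tame_comp hπ h3⟩
  · exact Or.inr ⟨x, ρ ∘ π, hx, hρ.comp hπ, rfl⟩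

theorem ReachesGood.comp {s : Fin 4 → ℕ} {π : Fin 4 → Fin 4} (hπ : Sym π) (h : ReachesGood a s) :
    ReachesGood a (s ∘ π) := by
  obtain ⟨k, hk⟩ := h
  exact ⟨k, by rw [rot_iterate_comp hπ]; exact hk.comp hπ⟩

theorem ReachesGood.of_iterate {s : Fin 4 → ℕ} (n : ℕ) (h : ReachesGood a ((rot a)^[n] s)) :
    ReachesGood a s := by
  obtain ⟨k, hk⟩ := h
  exact ⟨k + n, by rwa [Function.iterate_add_apply]⟩

theorem Good.reachesGood {s : Fin 4 → ℕ} (h : Good a s) : ReachesGood a s := ⟨0, h⟩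

theorem tame_vec {lo hi p q r s : ℕ} (hp : lo ≤ p ∧ p ≤ hi) (hq : lo ≤ q ∧ q ≤ hi)
    (hr : lo ≤ r ∧ r ≤ hi) (hs : lo ≤ s ∧ s ≤ hi) (hps : s = p ↔ lo = 0) (hqr : q = r ↔ lo = 0)
    (hpq : p = q ↔ hi = a + 1) (hrs : r = s ↔ hi = a + 1) : Tame a lo hi ![p, q, r, s] := by
  intro i
  fin_cases i
  · exact ⟨hp, hps, by rw [← hpq]; exact eq_comm⟩
  · exact ⟨hq, by rw [← hqr]; exact eq_comm, hpq⟩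
  · exact ⟨hr, hqr, by rw [← hrs]; exact eq_comm⟩
  · exact ⟨hs, by rw [← hps]; exact eq_comm, hrs⟩

theorem comp_vec (p q r s : ℕ) : (![p, q, r, s] : Fin 4 → ℕ) ∘ mx = ![q, p, s, r] ∧
    (![p, q, r, s] : Fin 4 → ℕ) ∘ mn = ![s, r, q, p] ∧
    (![p, q, r, s] : Fin 4 → ℕ) ∘ half = ![r, s, p, q] := by
  refine ⟨?_, ?_, ?_⟩ <;> funext i <;> fin_cases i <;> rfl

theorem reachesGood_max {x y : ℕ} (hx : 1 ≤ x ∧ x ≤ a) (hy : 1 ≤ y ∧ y ≤ a) (hxy : x ≠ y) :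
    ReachesGood a ![a + 1, a + 1, x, y] := by
  wlog hlt : x < y generalizing x y
  · have := (this hy hx hxy.symm (by omega)).comp sym_mx
    rwa [(comp_vec _ _ _ _).1] at this
  refine ReachesGood.of_iterate ((a - y) * (a + 1)) (Good.reachesGood (Or.inr
    ⟨x + (a - y), id, by omega, sym_id, ?_⟩))
  rw [(path_max_rounds hx.1 hy.1 hxy (a - y) (by omega) (by omega)).1, Nat.add_sub_cancel' hy.2]
  rfl

/-- The larger of `u, v` reaches `a` first; the synchrony then passes to a pair at a maximum, which
is `reachesGood_max` up to a half turn. -/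
theorem reachesGood_min {u v : ℕ} (hu : 1 ≤ u ∧ u ≤ a) (hv : 1 ≤ v ∧ v ≤ a) (huv : u ≠ v) :
    ReachesGood a ![0, u, v, 0] := by
  wlog hlt : u < v generalizing u v
  · have := (this hv hu huv.symm (by omega)).comp sym_mn
    rwa [(comp_vec _ _ _ _).2.1] at this
  refine ReachesGood.of_iterate ((a - v) * (a + 1)) ?_
  rw [(path_min_rounds hu.1 hv.1 huv (a - v) (by omega) (by omega)).1, Nat.add_sub_cancel' hv.2]
  refine ReachesGood.of_iterate (a + 1) ?_
  rw [(path_min_to_max (by omega)).1]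
  have := (reachesGood_max (a := a) (x := 1) (y := u + (a - v) + 1) (by omega) (by omega)
    (by omega)).comp sym_half
  rwa [(comp_vec _ _ _ _).2.2] at this

theorem eq_vec (s : Fin 4 → ℕ) : s = ![s 0, s 1, s 2, s 3] := by
  funext i; fin_cases i <;> rfl

theorem exists_sym (i : Fin 4) : ∃ π, Sym π ∧ π 0 = i ∧ π ∘ π = id := by
  fin_cases i
  · exact ⟨id, sym_id, rfl, rfl⟩
  · exact ⟨mx, sym_mx, rfl, by decide⟩
  · exact ⟨half, sym_half, rfl, by decide⟩
  · exact ⟨mn, sym_mn, rfl, by decide⟩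

theorem reachesGood_of_extreme {s : Fin 4 → ℕ} (hv : Valid a s) {i : Fin 4}
    (hi : s i = 0 ∨ s i = a + 1) : ReachesGood a s := by
  wlog h0 : i = 0 generalizing s i
  · obtain ⟨π, hπ, rfl, hππ⟩ := exists_sym i
    have := (this (valid_comp hπ hv) (i := 0) hi rfl).comp hπ
    rwa [Function.comp_assoc, hππ, Function.comp_id] at this
  subst h0
  have h0 := hv 0
  have h1 := hv 1
  have h2 := hv 2
  have h3 := hv 3
  simp only [mx, mn, Matrix.cons_val] at h0 h1 h2 h3
  rw [eq_vec s]
  generalize s 0 = p at *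
  generalize s 1 = q at *
  generalize s 2 = r at *
  generalize s 3 = t at *
  rcases hi with rfl | rfl
  · obtain rfl : t = 0 := by omega
    by_cases hqr : q = r
    · subst hqr
      by_cases hq : q = 0
      · exact Good.reachesGood (Or.inl ⟨0, a + 1, zero_le_one, Or.inr rfl,
          by apply tame_vec <;> omega⟩)
      · exact Good.reachesGood (Or.inl ⟨0, a, zero_le_one, Or.inl rfl,
          by apply tame_vec <;> omega⟩)
    · exact reachesGood_min (by omega) (by omega) hqr
  · obtain rfl : q = a + 1 := by omega
    by_cases hrt : r = t
    · subst hrt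
      by_cases hr : r = a + 1
      · exact Good.reachesGood (Or.inl ⟨0, a + 1, zero_le_one, Or.inr rfl,
          by apply tame_vec <;> omega⟩)
      · exact Good.reachesGood (Or.inl ⟨1, a + 1, le_rfl, Or.inr rfl,
          by apply tame_vec <;> omega⟩)
    · exact reachesGood_max (by omega) (by omega) hrt

/-- Two synchronous neighbours climb together until some chain becomes empty or full, where
`reachesGood_of_extreme` applies; `n` bounds the climb left. -/
theorem reachesGood_of_sync (ha : 0 < a) (n : ℕ) {s : Fin 4 → ℕ} (hv : Valid a s) {i : Fin 4}
    (hn : a ≤ s i + n) (hi : s (mn i) = s i ∨ s (mx i) = s i) : ReachesGood a s := by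
  by_cases hex : ∃ j, s j = 0 ∨ s j = a + 1
  · obtain ⟨j, hj⟩ := hex
    exact reachesGood_of_extreme hv hj
  push Not at hex
  have hrange : ∀ j, 1 ≤ s j ∧ s j ≤ a := fun j => by
    have := hv j
    have := hex j
    omega
  have hstep : ∀ j, s j < a → rot a s j = s j + 1 := fun j hj => by
    rw [rot, if_neg]
    unfold Falls
    omega
  by_cases hlt : s i < a
  · refine ReachesGood.of_iterate 1 ?_
    rw [Function.iterate_one]
    refine reachesGood_of_sync ha (n - 1) (valid_rot ha hv) (i := i) ?_ ?_
    · rw [hstep i hlt]; omega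
    · rcases hi with h | h
      · left
        rw [hstep i hlt, hstep _ (h ▸ hlt), h]
      · right
        rw [hstep i hlt, hstep _ (h ▸ hlt), h]
  · have hia : s i = a := by have := hrange i; omega
    have hup : ∀ j, s j = a → s (mx j) = a → ReachesGood a s := fun j h1 h2 => by
      refine ReachesGood.of_iterate 1 (reachesGood_of_extreme (valid_rot ha hv) (i := j) ?_)
      right
      change rot a s j = a + 1
      rw [rot, if_neg, h1]
      unfold Falls
      omega
    rcases hi with h | h
    -- A pair at a shared minimum has reached `a`. If either member meets its partner at the
    -- maximum, that chain fills up; otherwise both fall, and land at `0`.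
    · by_cases h1 : s (mx i) = a
      · exact hup i hia h1
      by_cases h2 : s (mx (mn i)) = a
      · exact hup (mn i) (by omega) h2
      refine ReachesGood.of_iterate 1 (reachesGood_of_extreme (valid_rot ha hv) (i := i) ?_)
      left
      change rot a s i = 0
      rw [rot, if_pos (show Falls a s i from Or.inr ⟨hia, h1⟩),
        if_pos (show Falls a s (mn i) from Or.inr ⟨by omega, h2⟩)]
    · exact hup i hia (by omega)
termination_by n
decreasing_by omega

theorem reachesGood (ha : 0 < a) {s : Fin 4 → ℕ} (hv : Valid a s) : ReachesGood a s := by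
  by_cases hsync : ∃ i, s (mn i) = s i ∨ s (mx i) = s i
  · obtain ⟨i, hi⟩ := hsync
    exact reachesGood_of_sync ha a hv (Nat.le_add_left _ _) hi
  by_cases hex : ∃ j, s j = 0 ∨ s j = a + 1
  · obtain ⟨j, hj⟩ := hex
    exact reachesGood_of_extreme hv hj
  push Not at hex hsync
  refine Good.reachesGood (Or.inl ⟨1, a, le_rfl, Or.inl rfl, fun i => ⟨?_, ?_, ?_⟩⟩)
  · have := hv i
    have := hex i
    omega
  · simp [(hsync i).1]
  · simp [(hsync i).2]

/-! ### The representatives -/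

/-- Proper colourings of a four-cycle with a fixed first colour. -/
def colourings (a : ℕ) : Finset (Σ _ : ℕ, ℕ × ℕ) :=
  (Finset.Icc 1 a).sigma fun y =>
    ((Finset.Icc 1 a).erase 1).erase y ×ˢ ((Finset.Icc 1 a).erase 1).erase y

/-- The vertex opposite the fixed one has colour `y`. With `b = a - 1`, the two remaining vertices
have `b ^ 2` colourings if `y = 1`, and `(b - 1) ^ 2` for each of the `b` other values. -/
theorem card_colourings (ha : 0 < a) :
    ((colourings a).card : ℤ) = (a : ℤ) ^ 3 - 4 * (a : ℤ) ^ 2 + 6 * (a : ℤ) - 3 := by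
  obtain ⟨b, rfl⟩ : ∃ b, a = b + 1 := ⟨a - 1, by omega⟩
  have h1 : (1 : ℕ) ∈ Finset.Icc 1 (b + 1) := by simp
  have hc : ((Finset.Icc 1 (b + 1)).erase 1).card = b := by
    rw [Finset.card_erase_of_mem h1]; simp
  rw [colourings, Finset.card_sigma, ← Finset.add_sum_erase _ _ h1]
  have h2 : ∀ y ∈ (Finset.Icc 1 (b + 1)).erase 1,
      ((((Finset.Icc 1 (b + 1)).erase 1).erase y ×ˢ
        ((Finset.Icc 1 (b + 1)).erase 1).erase y).card : ℤ) = ((b : ℤ) - 1) ^ 2 := by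
    intro y hy
    have hb : 0 < b := by rw [← hc]; exact Finset.card_pos.2 ⟨y, hy⟩
    rw [Finset.card_product, Finset.card_erase_of_mem hy, hc]
    push_cast [Nat.cast_sub hb]
    ring
  have h3 : (1 : ℕ) ∉ (Finset.Icc 1 (b + 1)).erase 1 := by simp
  rw [Nat.cast_add, Nat.cast_sum, Finset.sum_congr rfl h2, Finset.sum_const,
    Finset.erase_eq_of_notMem h3, Finset.card_product, hc, nsmul_eq_mul]
  push_cast
  ring

/-- The index set of the orbits. -/
abbrev OrbitIndex (a : ℕ) : Type :=
  colourings a ⊕ Fin a ⊕ Fin a ⊕ Unit ⊕ Fin (a - 1) ⊕ Fin (a - 1)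

/-- A representative of each orbit. -/
def rep (a : ℕ) : OrbitIndex a → Fin 4 → ℕ
  | .inl p => ![1, p.1.2.1, p.1.1, p.1.2.2]
  | .inr (.inl y) => ![1, 1, y.val + 2, y.val + 2]
  | .inr (.inr (.inl y)) => ![0, y.val + 1, y.val + 1, 0]
  | .inr (.inr (.inr (.inl _))) => ![0, 0, 0, 0]
  | .inr (.inr (.inr (.inr (.inl r)))) => swap a (r.val + 1)
  | .inr (.inr (.inr (.inr (.inr r)))) => swap a (r.val + 1) ∘ mx

/-- The size of each orbit. -/
def len (a : ℕ) : OrbitIndex a → ℕ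
  | .inl _ => a
  | .inr (.inl _) => a + 1
  | .inr (.inr (.inl _)) => a + 1
  | .inr (.inr (.inr (.inl _))) => a + 2
  | .inr (.inr (.inr (.inr (.inl _)))) => 2 * a ^ 2
  | .inr (.inr (.inr (.inr (.inr _)))) => 2 * a ^ 2

/-- The sum of a chainwise weight over each orbit. -/
def weight (a : ℕ) (φ : ℕ → ℤ) : OrbitIndex a → ℤ
  | .inl _ => 4 * inner a φ
  | .inr (.inl _) => 4 * (inner a φ + φ (a + 1))
  | .inr (.inr (.inl _)) => 4 * (φ 0 + inner a φ)
  | .inr (.inr (.inr (.inl _))) => 4 * (φ 0 + inner a φ + φ (a + 1))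
  | .inr (.inr (.inr (.inr (.inl r)))) =>
    2 * ((4 * a - 2) * inner a φ + 2 * (a - (r.val + 1)) * φ 0 + 2 * (r.val + 1) * φ (a + 1))
  | .inr (.inr (.inr (.inr (.inr r)))) =>
    2 * ((4 * a - 2) * inner a φ + 2 * (a - (r.val + 1)) * φ 0 + 2 * (r.val + 1) * φ (a + 1))

theorem len_pos (ha : 0 < a) (j : OrbitIndex a) : 0 < len a j := by
  rcases j with _ | _ | _ | _ | _ | _ <;> simp only [len] <;> positivity

theorem tame_colouring (p : colourings a) : Tame a 1 a ![1, p.1.2.1, p.1.1, p.1.2.2] := by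
  obtain ⟨⟨y, x, z⟩, hp⟩ := p
  simp only [colourings, Finset.mem_sigma, Finset.mem_product, Finset.mem_erase,
    Finset.mem_Icc] at hp
  change Tame a 1 a ![1, x, y, z]
  apply tame_vec <;> omega

theorem path_rep (ha : 0 < a) (j : OrbitIndex a) :
    Path a (len a j) (rep a j) (rep a j) fun φ => weight a φ j := by
  have e0 : ∀ (φ : ℕ → ℤ), ∑ k ∈ Finset.range (a + 1), φ (0 + k) = φ 0 + inner a φ := fun φ => by
    rw [Finset.sum_range_succ', inner, add_comm]
    simp only [zero_add, add_comm]
  have hsucc : ∀ r : Fin (a - 1), 1 ≤ r.val + 1 ∧ r.val + 1 < a := fun r => by omega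
  rcases j with p | y | y | _ | r | r
  · exact ((tame_colouring p).path_period le_rfl (Or.inl rfl) ha).congr (by simp [len])
      fun φ => by simp [weight, inner]
  · have ht : Tame a 1 (a + 1) ![1, 1, y.val + 2, y.val + 2] := by apply tame_vec <;> omega
    exact (ht.path_period le_rfl (Or.inr rfl) (by omega)).congr (by simp [len]) fun φ => by
      rw [weight, inner, Nat.add_sub_cancel, Finset.sum_range_succ, add_comm 1 a]
  · have ht : Tame a 0 a ![0, y.val + 1, y.val + 1, 0] := by apply tame_vec <;> omega
    exact (ht.path_period (by omega) (Or.inl rfl) (by omega)).congr (by simp [len]) fun φ => by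
      rw [weight, ← e0]; rfl
  · have ht : Tame a 0 (a + 1) ![0, 0, 0, 0] := by apply tame_vec <;> omega
    exact (ht.path_period (by omega) (Or.inr rfl) (by omega)).congr (by simp [len]) fun φ => by
      rw [weight, ← e0, Nat.sub_zero, Finset.sum_range_succ, zero_add (a + 1)]
  · exact (path_swap (hsucc r)).congr rfl fun φ => by simp [weight]
  · exact ((path_swap (hsucc r)).comp sym_mx).congr rfl fun φ => by simp [weight]

theorem valid_vec {p q r s : ℕ} (hp : p ≤ a + 1) (hq : q ≤ a + 1) (hr : r ≤ a + 1) (hs : s ≤ a + 1)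
    (h1 : p = 0 ↔ s = 0) (h2 : q = 0 ↔ r = 0) (h3 : p = a + 1 ↔ q = a + 1)
    (h4 : r = a + 1 ↔ s = a + 1) : Valid a ![p, q, r, s] := by
  intro i
  fin_cases i
  · exact ⟨hp, h1, h3⟩
  · exact ⟨hq, h2, h3.symm⟩
  · exact ⟨hr, h2.symm, h4⟩
  · exact ⟨hs, h1.symm, h4.symm⟩

theorem valid_swap {x : ℕ} (hx : 1 ≤ x ∧ x < a) : Valid a (swap a x) := by
  apply valid_vec <;> omega

theorem valid_rep (j : OrbitIndex a) : Valid a (rep a j) := by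
  rcases j with p | y | y | _ | r | r
  · have h := tame_colouring p
    have h0 := (h 0).1
    have h1 := (h 1).1
    have h2 := (h 2).1
    have h3 := (h 3).1
    simp only [Matrix.cons_val] at h0 h1 h2 h3
    apply valid_vec <;> omega
  · apply valid_vec <;> omega
  · apply valid_vec <;> omega
  · apply valid_vec <;> omega
  · exact valid_swap (by omega)
  · exact valid_comp sym_mx (valid_swap (by omega))

theorem exists_rep_of_tame (ha : 0 < a) {lo hi : ℕ} {s : Fin 4 → ℕ} (hlo : lo ≤ 1)
    (hhi : hi = a ∨ hi = a + 1) (h : Tame a lo hi s) (hs : s 0 = lo) : ∃ j, s = rep a j := by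
  have h0 := h 0
  have h1 := h 1
  have h2 := h 2
  have h3 := h 3
  simp only [mx, mn, Matrix.cons_val] at h0 h1 h2 h3
  rw [eq_vec s]
  generalize s 0 = p at *
  generalize s 1 = q at *
  generalize s 2 = r at *
  generalize s 3 = t at *
  subst hs
  have hp : p = 0 ∨ p = 1 := by omega
  rcases hp with rfl | rfl <;> rcases hhi with rfl | rfl
  · obtain rfl : t = 0 := by omega
    obtain rfl : r = q := by omega
    refine ⟨.inr (.inr (.inl ⟨r - 1, by omega⟩)), ?_⟩
    simp only [rep]
    rw [Nat.sub_add_cancel (by omega)]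
  · obtain rfl : t = 0 := by omega
    obtain rfl : r = 0 := by omega
    obtain rfl : q = 0 := by omega
    exact ⟨.inr (.inr (.inr (.inl ()))), rfl⟩
  · refine ⟨.inl ⟨⟨r, q, t⟩, ?_⟩, rfl⟩
    simp only [colourings, Finset.mem_sigma, Finset.mem_product, Finset.mem_erase,
      Finset.mem_Icc]
    omega
  · obtain rfl : q = 1 := by omega
    obtain rfl : t = r := by omega
    -- Since `lo = 1` forbids synchrony across minima, `t ≠ 1`, so `t` ranges over `2, …, a + 1`.
    refine ⟨.inr (.inl ⟨t - 2, by omega⟩), ?_⟩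
    simp only [rep]
    rw [Nat.sub_add_cancel (by omega)]

theorem exists_iterate_eq_rep (ha : 0 < a) {s : Fin 4 → ℕ} (hv : Valid a s) :
    ∃ j k, (rot a)^[k] s = rep a j := by
  obtain ⟨k, ⟨lo, hi, hlo, hhi, ht⟩ | ⟨x, π, hx, hπ, hs⟩⟩ := reachesGood ha hv
  · obtain ⟨l, hl1, hl2⟩ := ht.exists_iterate hlo hhi (by omega)
    obtain ⟨j, hj⟩ := exists_rep_of_tame ha hlo hhi hl1 hl2
    exact ⟨j, l + k, by rw [Function.iterate_add_apply, hj]⟩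
  · obtain ⟨j, hr⟩ : ∃ j, swap a x = rep a j := by
      refine ⟨.inr (.inr (.inr (.inr (.inl ⟨x - 1, by omega⟩)))), ?_⟩
      simp only [rep]
      rw [Nat.sub_add_cancel hx.1]
    obtain ⟨j', hr'⟩ : ∃ j, swap a x ∘ mx = rep a j := by
      refine ⟨.inr (.inr (.inr (.inr (.inr ⟨x - 1, by omega⟩)))), ?_⟩
      simp only [rep]
      rw [Nat.sub_add_cancel hx.1]
    rcases hπ.cases with rfl | rfl | rfl | rfl
    · exact ⟨j, k, hs.trans hr⟩
    · exact ⟨j', k, hs.trans hr'⟩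
    -- Half a period acts as the half turn, and `half ∘ mn = mx`.
    · refine ⟨j', a ^ 2 + k, ?_⟩
      rw [Function.iterate_add_apply, hs, ((path_swap_half hx).comp sym_mn).1, ← hr']
      funext i
      fin_cases i <;> rfl
    · refine ⟨j, a ^ 2 + k, ?_⟩
      rw [Function.iterate_add_apply, hs, ((path_swap_half hx).comp sym_half).1, ← hr]
      funext i
      fin_cases i <;> rfl

theorem sum_len (ha : 0 < a) : ∑ j, len a j = a ^ 4 + 4 * a ^ 2 + 2 := by
  have hc := card_colourings ha
  obtain ⟨b, rfl⟩ : ∃ b, a = b + 1 := ⟨a - 1, by omega⟩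
  simp only [Fintype.sum_sum_type, len, Finset.sum_const, Finset.card_univ, Fintype.card_coe,
    Fintype.card_fin, Fintype.card_unit, smul_eq_mul, Nat.add_sub_cancel]
  zify
  rw [hc]
  push_cast
  ring

/-! ### Counting order ideals -/

/-- Some height vectors; they are in fact all. -/
def vec (a : ℕ) : ((Fin a × Fin a) × (Fin a × Fin a)) ⊕ (Fin a × Fin a) ⊕ (Fin a × Fin a) ⊕
    (Fin a × Fin a) ⊕ (Fin a × Fin a) ⊕ Unit ⊕ Unit → Fin 4 → ℕ
  | .inl x => ![x.1.1 + 1, x.1.2 + 1, x.2.1 + 1, x.2.2 + 1]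
  | .inr (.inl x) => ![0, x.1 + 1, x.2 + 1, 0]
  | .inr (.inr (.inl x)) => ![x.1 + 1, 0, 0, x.2 + 1]
  | .inr (.inr (.inr (.inl x))) => ![a + 1, a + 1, x.1 + 1, x.2 + 1]
  | .inr (.inr (.inr (.inr (.inl x)))) => ![x.1 + 1, x.2 + 1, a + 1, a + 1]
  | .inr (.inr (.inr (.inr (.inr (.inl _))))) => ![0, 0, 0, 0]
  | .inr (.inr (.inr (.inr (.inr (.inr _))))) => ![a + 1, a + 1, a + 1, a + 1]

theorem valid_of_vec (x) : Valid a (vec a x) := by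
  rcases x with x | x | x | x | x | x | x <;> apply valid_vec <;> omega

theorem vec_injective : Function.Injective (vec a) := by
  intro x y h
  have h0 := congrFun h 0
  have h1 := congrFun h 1
  have h2 := congrFun h 2
  have h3 := congrFun h 3
  clear h
  rcases x with ⟨⟨x1, x2⟩, ⟨x3, x4⟩⟩ | ⟨x1, x2⟩ | ⟨x1, x2⟩ | ⟨x1, x2⟩ | ⟨x1, x2⟩ | x | x <;>
  rcases y with ⟨⟨y1, y2⟩, ⟨y3, y4⟩⟩ | ⟨y1, y2⟩ | ⟨y1, y2⟩ | ⟨y1, y2⟩ | ⟨y1, y2⟩ | y | y <;>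
  simp only [vec, Matrix.cons_val] at h0 h1 h2 h3 <;>
  first
  | rfl
  | (exfalso; omega)
  | (simp only [Sum.inl.injEq, Sum.inr.injEq, Prod.mk.injEq, Fin.ext_iff]; omega)

/-- The lower bound suffices: the covering argument supplies the reverse inequality. -/
theorem le_card_lowerSet (ha : 0 < a) [Fintype (LowerSet (Fence a ha))] :
    a ^ 4 + 4 * a ^ 2 + 2 ≤ Fintype.card (LowerSet (Fence a ha)) := by
  choose I hI using fun x => exists_ht_eq (ha := ha) (valid_of_vec (a := a) x)
  have hinj : Function.Injective I := fun x y h => vec_injective (by rw [← hI, ← hI, h])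
  refine le_of_eq_of_le ?_ (Fintype.card_le_of_injective I hinj)
  simp only [Fintype.card_sum, Fintype.card_prod, Fintype.card_fin, Fintype.card_unit]
  ring

/-! ### The statistics -/

theorem inner_sizeWeight : inner a (sizeWeight a) = (a : ℤ) ^ 2 := by
  have h : ∀ k ∈ Finset.range a, sizeWeight a (1 + k) = 2 * (k : ℤ) + 1 := fun k hk => by
    rw [Finset.mem_range] at hk
    rw [sizeWeight, if_neg (by omega), if_neg (by omega)]
    push_cast
    ring
  rw [inner, Finset.sum_congr rfl h]
  clear h
  induction a with
  | zero => rfl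
  | succ n ih => rw [Finset.sum_range_succ, ih]; push_cast; ring

theorem inner_maxWeight (ha : 0 < a) : inner a (maxWeight a) = 2 * (a : ℤ) - 2 := by
  obtain ⟨b, rfl⟩ : ∃ b, a = b + 1 := ⟨a - 1, by omega⟩
  have h : ∀ k ∈ Finset.range b, maxWeight (b + 1) (1 + (k + 1)) = 2 := fun k hk => by
    rw [Finset.mem_range] at hk
    rw [maxWeight, if_neg (by omega), if_neg (by omega), if_neg (by omega)]
  rw [inner, Finset.sum_range_succ', Finset.sum_congr rfl h]
  simp [maxWeight]
  ring

open Rowmotion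

variable {ha : 0 < a}

open scoped Classical in
theorem two_mul_sum_card (I : LowerSet (Fence a ha)) (n : ℕ) :
    2 * ((∑ k ∈ Finset.range n,
      ∑ v : Fence a ha, if v ∈ (rowmotion (Fence a ha))^[k] I then 1 else 0 : ℕ) : ℤ) =
      pathSum a (sizeWeight a) n (ht I) := by
  rw [Nat.cast_sum, Finset.mul_sum]
  refine Finset.sum_congr rfl fun k _ => ?_
  rw [two_mul_card, ht_rowmotion_iterate]

open scoped Classical in
theorem two_mul_sum_card_maximal (I : LowerSet (Fence a ha)) (n : ℕ)
    (hper : (rot a)^[n] (ht I) = ht I) :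
    2 * ((∑ k ∈ Finset.range n, ∑ v : Fence a ha,
      if Maximal (fun y => y ∈ (rowmotion (Fence a ha))^[k] I) v then 1 else 0 : ℕ) : ℤ) =
      pathSum a (maxWeight a) n (ht I) := by
  rw [Nat.cast_sum, Finset.mul_sum]
  have h : ∀ k ∈ Finset.range n, 2 * ((∑ v : Fence a ha,
      if Maximal (fun y => y ∈ (rowmotion (Fence a ha))^[k] I) v then 1 else 0 : ℕ) : ℤ) =
      ∑ i, maxWeight a ((rot a)^[k] (ht I) i) +
        (∑ i, bottomMax ((rot a)^[k] (ht I)) i - ∑ i, bottomMax ((rot a)^[k + 1] (ht I)) i) := by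
    intro k _
    have hv := valid_ht ((rowmotion (Fence a ha))^[k] I)
    rw [two_mul_card_maximal, Function.iterate_succ_apply', ← ht_rowmotion_iterate]
    simp only [bottomMax_rot ha hv]
    ring
  -- The `bottomMax` terms telescope and vanish because the path closes up.
  rw [Finset.sum_congr rfl h, Finset.sum_add_distrib,
    Finset.sum_range_sub' fun k => ∑ i, bottomMax ((rot a)^[k] (ht I)) i, hper]
  simp [pathSum]

theorem orbitData_fence (ha : 0 < a) :
    orbitData (Fence a ha) = Finset.univ.val.map fun j : OrbitIndex a =>
      ((len a j : ℤ), weight a (maxWeight a) j / 2, weight a (sizeWeight a) j / 2) := by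
  classical
  have : Fintype (LowerSet (Fence a ha)) := Fintype.ofFinite _
  choose x hx using fun j => exists_ht_eq (ha := ha) (valid_rep (a := a) j)
  have hper : ∀ j, (rowmotion (Fence a ha))^[len a j] (x j) = x j := fun j =>
    ht_injective (by rw [ht_rowmotion_iterate, hx, (path_rep ha j).1])
  have hcov : ∀ y, ∃ j k, (rowmotion (Fence a ha))^[k] y = x j := fun y => by
    obtain ⟨j, k, hk⟩ := exists_iterate_eq_rep ha (valid_ht y)
    exact ⟨j, k, ht_injective (by rw [ht_rowmotion_iterate, hx, hk])⟩
  rw [orbitData_eq (len_pos ha) hper hcov ((sum_len ha).trans_le (le_card_lowerSet ha))]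
  refine Multiset.map_congr rfl fun j _ => ?_
  have h1 := two_mul_sum_card_maximal (x j) (len a j) (by rw [hx, (path_rep ha j).1])
  have h2 := two_mul_sum_card (x j) (len a j)
  rw [hx] at h1 h2
  replace h1 := h1.trans ((path_rep ha j).2 _)
  replace h2 := h2.trans ((path_rep ha j).2 _)
  beta_reduce at h1 h2
  -- The weights are twice the statistics, so the integer divisions by `2` are exact.
  rw [← h1, ← h2, Int.mul_ediv_cancel_left _ two_ne_zero, Int.mul_ediv_cancel_left _ two_ne_zero]

/-! ### Splitting the multiset of orbit data along the index type. -/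

theorem map_univ_sum {α β γ : Type*} [Fintype α] [Fintype β] (f : α ⊕ β → γ) :
    (Finset.univ : Finset (α ⊕ β)).val.map f =
      (Finset.univ : Finset α).val.map (fun x => f (.inl x)) +
        (Finset.univ : Finset β).val.map (fun x => f (.inr x)) := by
  rw [← Finset.univ_disjSum_univ, Finset.val_disjSum, Multiset.disjSum, Multiset.map_add,
    Multiset.map_map, Multiset.map_map]
  rfl

theorem map_univ_const {α γ : Type*} [Fintype α] (c : γ) :
    (Finset.univ : Finset α).val.map (fun _ => c) = Multiset.replicate (Fintype.card α) c := by
  rw [Multiset.map_const']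
  rfl

/-- The two families of long orbits, mirror images under `mx`, have equal data and merge into pairs
indexed by `r`. -/
theorem map_univ_fin {γ : Type*} (n : ℕ) (f : ℕ → γ) :
    (Finset.univ : Finset (Fin n)).val.map (fun r => f r.val) +
      (Finset.univ : Finset (Fin n)).val.map (fun r => f r.val) =
      ∑ r ∈ Finset.range n, Multiset.replicate 2 (f r) := by
  have h : (Finset.univ : Finset (Fin n)).val.map (fun r => f r.val) =
      ∑ r ∈ Finset.range n, {f r} := by
    rw [← Fin.sum_univ_eq_sum_range (fun r => ({f r} : Multiset γ)), Finset.sum,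
      ← Multiset.sum_map_singleton (Multiset.map _ _), Multiset.map_map]
    rfl
  rw [h, ← Finset.sum_add_distrib]
  rfl

end FourFence

theorem mainTheorem8 (a : ℕ) (ha : 0 < a) :
    ∃ N : ℕ, (N : ℤ) = (a : ℤ) ^ 3 - 4 * (a : ℤ) ^ 2 + 6 * (a : ℤ) - 3 ∧
      Rowmotion.orbitData (CircularFence (s := 2) (fun _ => a.toPNat ha)) =
        Multiset.replicate N
            ((a : ℤ), 4 * (a : ℤ) - 4, 2 * (a : ℤ) * (a : ℤ))
        + Multiset.replicate a
            ((a : ℤ) + 1, 4 * (a : ℤ) - 2, 2 * (a : ℤ) * (((a : ℤ) + 1) + 1))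
        + Multiset.replicate a
            ((a : ℤ) + 1, 4 * (a : ℤ) - 2, 2 * (a : ℤ) * (((a : ℤ) + 1) - 1))
        + Multiset.replicate 1
            ((a : ℤ) + 2, 4 * (a : ℤ), 2 * (a : ℤ) * ((a : ℤ) + 2))
        + ∑ r ∈ Finset.range (a - 1),
            Multiset.replicate 2
              (2 * (a : ℤ) ^ 2, 8 * (a : ℤ) ^ 2 - 10 * (a : ℤ) + 4,
                4 * (a : ℤ) ^ 3 - 2 * (a : ℤ) ^ 2 + 4 * (a : ℤ) + 4 * (r : ℤ) * (a : ℤ)) := by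
  refine ⟨_, FourFence.card_colourings ha, ?_⟩
  have h0 : FourFence.maxWeight a 0 = 1 := rfl
  have h1 : FourFence.maxWeight a (a + 1) = 1 := by simp [FourFence.maxWeight, ha.ne']
  have h2 : FourFence.sizeWeight a 0 = 0 := rfl
  have h3 : FourFence.sizeWeight a (a + 1) = 2 * a := by simp [FourFence.sizeWeight]
  have hdiv : ∀ {x y : ℤ}, x = 2 * y → x / 2 = y := fun h => by omega
  rw [FourFence.orbitData_fence ha]
  simp only [FourFence.map_univ_sum, ← add_assoc]
  have key := FourFence.map_univ_fin (a - 1) fun r => (2 * (a : ℤ) ^ 2,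
    8 * (a : ℤ) ^ 2 - 10 * (a : ℤ) + 4,
    4 * (a : ℤ) ^ 3 - 2 * (a : ℤ) ^ 2 + 4 * (a : ℤ) + 4 * (r : ℤ) * (a : ℤ))
  rw [← key, ← add_assoc]
  simp only [FourFence.len, FourFence.weight, FourFence.inner_sizeWeight,
    FourFence.inner_maxWeight ha, h0, h1, h2, h3, FourFence.map_univ_const, Fintype.card_coe,
    Fintype.card_fin, Fintype.card_unit]
  congr 1
  · congr 1
    · congr 1
      · congr 1
        · congr 1
          · refine congrArg _ (Prod.ext rfl (Prod.ext (hdiv ?_) (hdiv ?_))) <;> ring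
          · refine congrArg _ (Prod.ext ?_ (Prod.ext (hdiv ?_) (hdiv ?_)))
            · push_cast; ring
            · ring
            · ring
        · refine congrArg _ (Prod.ext ?_ (Prod.ext (hdiv ?_) (hdiv ?_)))
          · push_cast; ring
          · ring
          · ring
      · refine congrArg _ (Prod.ext ?_ (Prod.ext (hdiv ?_) (hdiv ?_)))
        · push_cast; ring
        · ring
        · ring
    · refine Multiset.map_congr rfl fun r _ => Prod.ext ?_ (Prod.ext (hdiv ?_) (hdiv ?_))
      · push_cast; ring
      · ring
      · ring
  · refine Multiset.map_congr rfl fun r _ => Prod.ext ?_ (Prod.ext (hdiv ?_) (hdiv ?_))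
    · push_cast; ring
    · ring
    · ring
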